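/- \textbf{Theorem (Global Subsolution).} Let $n\ge 3$, $p>n$, $2(2-n)<\gamma<0$, $\delta=\gamma/2$, and let $$N=\tfrac{2n}{n-2},\qquad c_n=\tfrac{n-2}{4(n-1)},\qquad b_n=\tfrac{n-2}{4n}.$$ Let $(M^n,g)$ be an asymptotically Euclidean manifold of class $W^{2,p}_\gamma$. This means that $M$ is a smooth manifold which, outside a compact set, is a finite non-empty disjoint union of ends $E_j$ diffeomorphic to exteriors of balls in $\mathbb R^n$, and that $g$ is a complete continuous Riemannian metric of class $W^{2,p}_{loc}$ with $g-g_{\rm Euc}\in W^{2,p}_\gamma$ on each end. Here $u\in W^{k,p}_\delta$ means that $u\in W^{k,p}_{loc}(M)$ and, for all $|\beta|\le k$, $\bigl\||x|^{-\delta-n/p+|\beta|}\partial^\beta u\bigr\|_{L^p}<\infty$ on each end (with $n/\infty=0$); $L^p_\delta=W^{0,p}_\delta$; tensors are treated componentwise. Let $(\sigma,\tau,\rho,J)$ be conformal data on $(M,g)$ with the following properties: $\sigma\in L^\infty_{\delta-1}$ is a symmetric $2$-tensor, trace free and (weakly) divergence free with respect to $g$; $\tau\in W^{1,p}_{\delta-1}$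 is a function; $\rho\ge 0$ is a function with $\rho\in L^\infty_{2\delta-2}$ or $\rho\in L^p_{\delta-2}$; and $J\in L^p_{\delta-2}$ is a vector field. (This covers both the far-from-CMC data, where in addition the Yamabe invariant of $g$ is positive and $\sigma,\rho,J$ are small, and the near-CMC data, where in addition the Yamabe invariant is positive and $\tau-Br^{2\delta-2}\|d\tau\|_{L^p_{\delta-2}}>0$; none of these additional conditions is needed.) With $(\mathcal D W)_{ij}=\nabla_iW_j+\nabla_jW_i-\frac2n(\operatorname{div}_gW)g_{ij}$, put $$\mathcal N(u,W)=\Delta_g u-c_nR_gu+c_n|\sigma+\mathcal DW|_g^2u^{-N-1}-b_n\tau^2u^{N-1}+c_n\rho\,u^{-N/2},$$ and for a positive function $\phi$ let $W(\phi)\in W^{2,p}_\delta$ denote any vector field solving $$-\operatorname{div}_g(\mathcal DW)+\tfrac{n-1}{n}\phi^N\nabla\tau+J=0 .$$ A positive function $\phi_-\in W^{2,p}_{loc}$ is called a \emph{global subsolution} if $\mathcal N(\phi_-,W(\phi))\ge0$ a.e. for every $\phi\in L^p_{loc}$ with $\phi\ge\phi_-$ and every such solution $W(\phi)$. Let $\psi\in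 W^{2,p}_\delta$ (taken as its continuous representative) satisfy $1+\psi>0$, and suppose that $\tilde g=(1+\psi)^{N-2}g$ has scalar curvature $R_{\tilde g}=-\frac{n-1}{n}\tau^2$. Then for every $0<\alpha\le1$ the function $\alpha(1+\psi)$ is a global subsolution. Moreover, $\mathcal N(\alpha(1+\psi),W(\phi))\ge0$ a.e. holds for every positive $\phi\in L^p_{loc}$ and every such solution $W(\phi)$, without requiring $\phi\ge\alpha(1+\psi)$. -/

import Mathlib

open MeasureTheory Manifold Bundle
open scoped ContDiff ENNReal

noncomputable section

namespace AEConstraint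

/-! ### Weak derivatives and Sobolev conditions on open subsets of `ℝⁿ` -/

/-- Euclidean space `ℝⁿ`. -/
abbrev Euc (n : ℕ) : Type := EuclideanSpace ℝ (Fin n)

/-- `h` is a weak partial derivative `∂ᵢ f` on the open set `Ω`. -/
def IsWeakPartial {n : ℕ} (Ω : Set (Euc n)) (i : Fin n) (f h : Euc n → ℝ) : Prop :=
  LocallyIntegrableOn f Ω ∧ LocallyIntegrableOn h Ω ∧
    ∀ φ : Euc n → ℝ, ContDiff ℝ ∞ φ → HasCompactSupport φ → tsupport φ ⊆ Ω →
      ∫ x, f x * fderiv ℝ φ x (EuclideanSpace.single i 1) = - ∫ x, h x * φ x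

open Classical in
/-- The weak partial derivative `∂ᵢ f` on `Ω`, unique up to null sets where it exists
(and `0` by convention if it does not exist). -/
def weakPartial {n : ℕ} (Ω : Set (Euc n)) (i : Fin n) (f : Euc n → ℝ) : Euc n → ℝ :=
  if hf : ∃ h, IsWeakPartial Ω i f h then hf.choose else 0

/-- Iterated weak partial derivative `∂^β f`; the multi-index `β` is given as a list of directions. -/
def weakIter {n : ℕ} (Ω : Set (Euc n)) (f : Euc n → ℝ) : List (Fin n) → Euc n → ℝ
  | [] => f
  | i :: β => weakPartial Ω i (weakIter Ω f β)

/-- All weak derivatives of `f` of order at most `k` exist on `Ω`. -/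
def HasWeakDerivs {n : ℕ} (k : ℕ) (Ω : Set (Euc n)) (f : Euc n → ℝ) : Prop :=
  ∀ β : List (Fin n), β.length < k → ∀ i, ∃ h, IsWeakPartial Ω i (weakIter Ω f β) h

/-- `f ∈ W^{k,p}_loc(Ω)`. -/
def MemWLoc {n : ℕ} (k : ℕ) (p : ℝ≥0∞) (Ω : Set (Euc n)) (f : Euc n → ℝ) : Prop :=
  HasWeakDerivs k Ω f ∧
    ∀ β : List (Fin n), β.length ≤ k → ∀ C ⊆ Ω, IsCompact C →
      MemLp (weakIter Ω f β) p (volume.restrict C)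

/-- Weighted Sobolev condition on an exterior domain `Ω`: all weak derivatives up to order `k` exist
and `|x|^{-δ - n/p + |β|} ∂^β f ∈ L^p(Ω)` for `|β| ≤ k`, where `n/∞ = 0`. -/
def MemWWeighted {n : ℕ} (k : ℕ) (p : ℝ≥0∞) (δ : ℝ) (Ω : Set (Euc n)) (f : Euc n → ℝ) : Prop :=
  HasWeakDerivs k Ω f ∧
    ∀ β : List (Fin n), β.length ≤ k →
      MemLp (fun x => ‖x‖ ^ (-δ - (n : ℝ) * (p⁻¹).toReal + (β.length : ℝ)) * weakIter Ω f β x)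
        p (volume.restrict Ω)

/-! ### Coordinate tensor calculus -/

/-- Inverse metric coefficients `g^{ij}`. -/
def invMetric {n : ℕ} (G : Fin n → Fin n → Euc n → ℝ) (i j : Fin n) (x : Euc n) : ℝ :=
  (Matrix.of fun a b => G a b x)⁻¹ i j

/-- Christoffel symbols `Γᵏᵢⱼ = ½ g^{kl} (∂ᵢ g_{jl} + ∂ⱼ g_{il} - ∂ₗ g_{ij})`. -/
def christoffel {n : ℕ} (Ω : Set (Euc n)) (G : Fin n → Fin n → Euc n → ℝ)
    (k i j : Fin n) (x : Euc n) : ℝ :=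
  1 / 2 * ∑ l, invMetric G k l x *
    (weakPartial Ω i (G j l) x + weakPartial Ω j (G i l) x - weakPartial Ω l (G i j) x)

/-- The Riemann tensor `R_{iklm} = ½ (∂ₖ∂ₗ g_{im} + ∂ᵢ∂ₘ g_{kl} - ∂ₖ∂ₘ g_{il} - ∂ᵢ∂ₗ g_{km})
  + g_{ab} (Γᵃₖₗ Γᵇᵢₘ - Γᵃₖₘ Γᵇᵢₗ)`, with the sign for which `Ric_{km} = g^{il} R_{iklm}`
and round spheres have positive curvature. -/
def riemann {n : ℕ} (Ω : Set (Euc n)) (G : Fin n → Fin n → Euc n → ℝ)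
    (i k l m : Fin n) (x : Euc n) : ℝ :=
  1 / 2 * (weakPartial Ω k (weakPartial Ω l (G i m)) x
      + weakPartial Ω i (weakPartial Ω m (G k l)) x
      - weakPartial Ω k (weakPartial Ω m (G i l)) x
      - weakPartial Ω i (weakPartial Ω l (G k m)) x)
    + ∑ a, ∑ b, G a b x *
      (christoffel Ω G a k l x * christoffel Ω G b i m x
        - christoffel Ω G a k m x * christoffel Ω G b i l x)

/-- Scalar curvature `R = g^{km} g^{il} R_{iklm}`. -/
def scalarCurv {n : ℕ} (Ω : Set (Euc n)) (G : Fin n → Fin n → Euc n → ℝ) (x : Euc n) : ℝ :=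
  ∑ i, ∑ k, ∑ l, ∑ m, invMetric G k m x * invMetric G i l x * riemann Ω G i k l m x

/-- Laplace-Beltrami operator `Δ_g u = g^{ij} (∂ᵢ∂ⱼ u - Γᵏᵢⱼ ∂ₖ u)`. -/
def laplace {n : ℕ} (Ω : Set (Euc n)) (G : Fin n → Fin n → Euc n → ℝ) (u : Euc n → ℝ)
    (x : Euc n) : ℝ :=
  ∑ i, ∑ j, invMetric G i j x *
    (weakPartial Ω i (weakPartial Ω j u) x - ∑ k, christoffel Ω G k i j x * weakPartial Ω k u x)

/-- Covariant derivative `∇ᵢ Wᵏ = ∂ᵢ Wᵏ + Γᵏᵢₗ Wˡ` of a vector field. -/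
def covDeriv {n : ℕ} (Ω : Set (Euc n)) (G : Fin n → Fin n → Euc n → ℝ)
    (W : Fin n → Euc n → ℝ) (i k : Fin n) (x : Euc n) : ℝ :=
  weakPartial Ω i (W k) x + ∑ l, christoffel Ω G k i l x * W l x

/-- Conformal Killing operator `(𝒟W)ᵢⱼ = ∇ᵢ Wⱼ + ∇ⱼ Wᵢ - (2/n) (div W) gᵢⱼ`. -/
def confKilling {n : ℕ} (Ω : Set (Euc n)) (G : Fin n → Fin n → Euc n → ℝ)
    (W : Fin n → Euc n → ℝ) (i j : Fin n) (x : Euc n) : ℝ :=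
  ∑ k, G j k x * covDeriv Ω G W i k x + ∑ k, G i k x * covDeriv Ω G W j k x
    - 2 / (n : ℝ) * (∑ k, covDeriv Ω G W k k x) * G i j x

/-- `|T|²_g = g^{ik} g^{jl} Tᵢⱼ Tₖₗ`. -/
def normSq {n : ℕ} (G T : Fin n → Fin n → Euc n → ℝ) (x : Euc n) : ℝ :=
  ∑ i, ∑ j, ∑ k, ∑ l, invMetric G i k x * invMetric G j l x * T i j x * T k l x

/-- `T^i_j = g^{ia} T_{aj}`. -/
def raise {n : ℕ} (G T : Fin n → Fin n → Euc n → ℝ) (i j : Fin n) (x : Euc n) : ℝ :=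
  ∑ a, invMetric G i a x * T a j x

/-- The identity `div_g T = f` on `Ω` in the weak sense, for a symmetric covariant `2`-tensor `T`
and a covector field `f`: for all test vector fields `X = φ ∂ⱼ`,
`∫ ⟨T, ∇X⟩ dV_g = - ∫ f(X) dV_g`, where `dV_g = √(det g) dx`. -/
def WeakDivEq {n : ℕ} (Ω : Set (Euc n)) (G T : Fin n → Fin n → Euc n → ℝ)
    (f : Fin n → Euc n → ℝ) : Prop :=
  (∀ i j, LocallyIntegrableOn (T i j) Ω) ∧ (∀ j, LocallyIntegrableOn (f j) Ω) ∧
    ∀ j, ∀ φ : Euc n → ℝ, ContDiff ℝ ∞ φ → HasCompactSupport φ → tsupport φ ⊆ Ω →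
      ∫ x in Ω, (∑ i, raise G T i j x * fderiv ℝ φ x (EuclideanSpace.single i 1)
          + ∑ i, ∑ k, raise G T i k x * christoffel Ω G k i j x * φ x)
          * Real.sqrt (Matrix.of fun a b => G a b x).det
        = - ∫ x in Ω, f j x * φ x * Real.sqrt (Matrix.of fun a b => G a b x).det

/-! ### Fields on a manifold and their components in charts -/

section Manifold

variable {n : ℕ} {M : Type*} [TopologicalSpace M] [ChartedSpace (Euc n) M]

/-- The smooth charts of `M` (the maximal smooth atlas). -/
abbrev Charts (n : ℕ) (M : Type*) [TopologicalSpace M] [ChartedSpace (Euc n) M] :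
    Set (OpenPartialHomeomorph M (Euc n)) :=
  IsManifold.maximalAtlas 𝓘(ℝ, Euc n) ∞ M

/-- Vector fields (without regularity). -/
abbrev VField (n : ℕ) (M : Type*) [TopologicalSpace M] [ChartedSpace (Euc n) M] : Type _ :=
  ∀ q : M, TangentSpace 𝓘(ℝ, Euc n) q

/-- Covariant `2`-tensor fields (without regularity). -/
abbrev TField (n : ℕ) (M : Type*) [TopologicalSpace M] [ChartedSpace (Euc n) M] : Type _ :=
  ∀ q : M, TangentSpace 𝓘(ℝ, Euc n) q →L[ℝ] TangentSpace 𝓘(ℝ, Euc n) q →L[ℝ] ℝ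

/-- The coordinate vector `∂ᵢ` of the chart `e` at the point with coordinates `x`. -/
def coordVec (e : OpenPartialHomeomorph M (Euc n)) (i : Fin n) (x : Euc n) :
    TangentSpace 𝓘(ℝ, Euc n) (e.symm x) :=
  mfderiv 𝓘(ℝ, Euc n) 𝓘(ℝ, Euc n) e.symm x
    (EuclideanSpace.single i (1 : ℝ) : Euc n)

/-- A function in the chart `e`. -/
def fcomp (u : M → ℝ) (e : OpenPartialHomeomorph M (Euc n)) (x : Euc n) : ℝ := u (e.symm x)

/-- The components `Tᵢⱼ` of a covariant `2`-tensor field in the chart `e`. -/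
def tcomp (T : TField n M) (e : OpenPartialHomeomorph M (Euc n)) (i j : Fin n) (x : Euc n) : ℝ :=
  T (e.symm x) (coordVec e i x) (coordVec e j x)

/-- The components `Wⁱ` of a vector field in the chart `e`. -/
def vcomp (W : VField n M) (e : OpenPartialHomeomorph M (Euc n)) (i : Fin n) (x : Euc n) : ℝ :=
  (EuclideanSpace.proj i : Euc n →L[ℝ] ℝ)
    (mfderiv 𝓘(ℝ, Euc n) 𝓘(ℝ, Euc n) e (e.symm x) (W (e.symm x)))

/-- A pointwise condition, expressed in charts, holds almost everywhere on `M`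
(null sets of a manifold are those that are Lebesgue null in every smooth chart). -/
def AEOn (P : OpenPartialHomeomorph M (Euc n) → Euc n → Prop) : Prop :=
  ∀ e ∈ Charts n M, ∀ᵐ x ∂(volume.restrict e.target), P e x

/-- `M` is, outside a compact set, a finite disjoint union of ends diffeomorphic to exteriors of
balls in `ℝⁿ`. The exterior coordinate systems on the ends are part of the structure. -/
structure AsymptoticEnds (n : ℕ) (M : Type*) [TopologicalSpace M] [ChartedSpace (Euc n) M] where
  core : Set M
  isCompact_core : IsCompact core
  numEnds : ℕ
  numEnds_pos : 0 < numEnds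
  radius : Fin numEnds → ℝ
  radius_pos : ∀ j, 0 < radius j
  endChart : Fin numEnds → OpenPartialHomeomorph M (Euc n)
  endChart_mem : ∀ j, endChart j ∈ Charts n M
  endChart_target : ∀ j, (endChart j).target = {x | radius j < ‖x‖}
  disjoint_ends : Pairwise fun j k => Disjoint (endChart j).source (endChart k).source
  iUnion_ends : ⋃ j, (endChart j).source = coreᶜ

/-- Membership in `W^{k,p}_δ` of a component of a field, which is given in every chart `e` as a
function `c e` of the coordinates: `W^{k,p}_loc` in all charts, and the weighted condition on
the ends. -/
def MemW (A : AsymptoticEnds n M) (k : ℕ) (p : ℝ≥0∞) (δ : ℝ)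
    (c : OpenPartialHomeomorph M (Euc n) → Euc n → ℝ) : Prop :=
  (∀ e ∈ Charts n M, MemWLoc k p e.target (c e)) ∧
    ∀ j, MemWWeighted k p δ (A.endChart j).target (c (A.endChart j))

/-- Continuous Riemannian metrics on `M`. -/
abbrev Metric (n : ℕ) (M : Type*) [TopologicalSpace M] [ChartedSpace (Euc n) M]
    [IsManifold 𝓘(ℝ, Euc n) ∞ M] : Type _ :=
  haveI : IsManifold 𝓘(ℝ, Euc n) 1 M := IsManifold.of_le (n := ∞) (by simp)
  ContinuousRiemannianMetric (Euc n) (fun q : M => TangentSpace 𝓘(ℝ, Euc n) q)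

variable [IsManifold 𝓘(ℝ, Euc n) ∞ M]

/-- The metric `g` as a covariant `2`-tensor field. -/
def Metric.tensor (g : Metric n M) : TField n M := fun q => g.inner q

/-- Completeness of `g`: sequences which are Cauchy for the Riemannian distance converge. -/
def Metric.IsComplete (g : Metric n M) : Prop :=
  haveI : IsManifold 𝓘(ℝ, Euc n) 1 M := IsManifold.of_le (n := ∞) (by simp)
  letI : RiemannianBundle (fun q : M => TangentSpace 𝓘(ℝ, Euc n) q) := ⟨g.toRiemannianMetric⟩
  ∀ u : ℕ → M,
    (∀ ε : ℝ≥0∞, 0 < ε → ∃ m₀, ∀ m ≥ m₀, ∀ k ≥ m₀,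
      riemannianEDist 𝓘(ℝ, Euc n) (u m) (u k) < ε) →
    ∃ q, Filter.Tendsto u Filter.atTop (nhds q)

/-- `(M, g)` is asymptotically Euclidean of class `W^{k,p}_γ`: `g` is complete, of class
`W^{k,p}_loc`, and `g - g_Euc ∈ W^{k,p}_γ` on each end. -/
def IsAE (A : AsymptoticEnds n M) (k : ℕ) (p : ℝ≥0∞) (γ : ℝ) (g : Metric n M) : Prop :=
  g.IsComplete ∧
  (∀ e ∈ Charts n M, ∀ i j, MemWLoc k p e.target (tcomp g.tensor e i j)) ∧
    ∀ a i j, MemWWeighted k p γ (A.endChart a).target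
      fun x => tcomp g.tensor (A.endChart a) i j x - if i = j then 1 else 0

/-- A covariant `2`-tensor field has scalar curvature `s` (almost everywhere). -/
def HasScalarCurv (T : TField n M) (s : M → ℝ) : Prop :=
  AEOn (n := n) (M := M) fun e x => scalarCurv e.target (tcomp T e) x = s (e.symm x)

/-! ### The conformal constraint equations -/

/-- `N = 2n/(n-2)`. -/
def expN (n : ℕ) : ℝ := 2 * (n : ℝ) / ((n : ℝ) - 2)

/-- `c_n = (n-2)/(4(n-1))`. -/
def constC (n : ℕ) : ℝ := ((n : ℝ) - 2) / (4 * ((n : ℝ) - 1))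

/-- `b_n = (n-2)/(4n)`. -/
def constB (n : ℕ) : ℝ := ((n : ℝ) - 2) / (4 * (n : ℝ))

/-- The fields `(g, σ, τ, ρ, J)` of a set of conformal data on `M`. -/
structure ConformalData (n : ℕ) (M : Type*) [TopologicalSpace M] [ChartedSpace (Euc n) M]
    [IsManifold 𝓘(ℝ, Euc n) ∞ M] where
  g : Metric n M
  σ : TField n M
  τ : M → ℝ
  ρ : M → ℝ
  J : VField n M

/-- The components of `g` in a chart. -/
def ConformalData.G (D : ConformalData n M) (e : OpenPartialHomeomorph M (Euc n)) :
    Fin n → Fin n → Euc n → ℝ := tcomp D.g.tensor e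

/-- `σ` is symmetric, and trace free and divergence free with respect to `g`. -/
def ConformalData.IsTT (D : ConformalData n M) : Prop :=
  AEOn (fun e x => ∀ i j, tcomp D.σ e i j x = tcomp D.σ e j i x) ∧
  AEOn (fun e x => ∑ i, ∑ j, invMetric (D.G e) i j x * tcomp D.σ e i j x = 0) ∧
  ∀ e ∈ Charts n M, WeakDivEq e.target (D.G e) (tcomp D.σ e) 0

/-- Asymptotically Euclidean conformal data with weights `γ` and `δ = γ/2`. The two alternatives
for `ρ` are those of far-from-CMC and of near-CMC data. -/
structure ConformalData.IsAdmissible (D : ConformalData n M) (A : AsymptoticEnds n M)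
    (p γ : ℝ) : Prop where
  metric : IsAE A 2 (ENNReal.ofReal p) γ D.g
  sigma_tt : D.IsTT
  sigma_mem : ∀ i j, MemW A 0 ⊤ (γ / 2 - 1) fun e => tcomp D.σ e i j
  tau_mem : MemW A 1 (ENNReal.ofReal p) (γ / 2 - 1) (fcomp D.τ)
  rho_nonneg : AEOn (n := n) (M := M) fun e x => 0 ≤ D.ρ (e.symm x)
  rho_mem : MemW A 0 ⊤ (2 * (γ / 2) - 2) (fcomp D.ρ) ∨
    MemW A 0 (ENNReal.ofReal p) (γ / 2 - 2) (fcomp D.ρ)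
  J_mem : ∀ i, MemW A 0 (ENNReal.ofReal p) (γ / 2 - 2) fun e => vcomp D.J e i

/-- The Lichnerowicz operator `𝒩(u, W) = Δ_g u - c_n R_g u + c_n |σ + 𝒟W|²_g u^{-N-1}
  - b_n τ² u^{N-1} + c_n ρ u^{-N/2}` in the chart `e`. -/
def ConformalData.lichnerowicz (D : ConformalData n M) (u : M → ℝ) (W : VField n M)
    (e : OpenPartialHomeomorph M (Euc n)) (x : Euc n) : ℝ :=
  laplace e.target (D.G e) (fcomp u e) x
    - constC n * scalarCurv e.target (D.G e) x * u (e.symm x)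
    + constC n * normSq (D.G e)
        (fun i j y => tcomp D.σ e i j y + confKilling e.target (D.G e) (vcomp W e) i j y) x
        * u (e.symm x) ^ (-expN n - 1)
    - constB n * D.τ (e.symm x) ^ 2 * u (e.symm x) ^ (expN n - 1)
    + constC n * D.ρ (e.symm x) * u (e.symm x) ^ (-(expN n / 2))

/-- `W` is a solution `W(v) ∈ W^{2,p}_δ` of `Δ_𝕃 W + ((n-1)/n) v^N ∇τ + J = 0`, where
`Δ_𝕃 = -div ∘ 𝒟`; in covariant components, `div(𝒟W)ⱼ = ((n-1)/n) v^N ∂ⱼτ + gⱼₖ Jᵏ`. -/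
def ConformalData.SolvesVector (D : ConformalData n M) (A : AsymptoticEnds n M) (p δ : ℝ)
    (v : M → ℝ) (W : VField n M) : Prop :=
  (∀ i, MemW A 2 (ENNReal.ofReal p) δ fun e => vcomp W e i) ∧
  ∀ e ∈ Charts n M, WeakDivEq e.target (D.G e) (confKilling e.target (D.G e) (vcomp W e))
    fun j x => ((n : ℝ) - 1) / (n : ℝ) * v (e.symm x) ^ expN n * weakPartial e.target j (fcomp D.τ e) x
      + ∑ k, D.G e j k x * vcomp D.J e k x

/-- `v ∈ L^p_loc(M)`. -/
def MemLpLoc (n : ℕ) {M : Type*} [TopologicalSpace M] [ChartedSpace (Euc n) M] (p : ℝ)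
    (v : M → ℝ) : Prop :=
  ∀ e ∈ Charts n M, MemWLoc 0 (ENNReal.ofReal p) e.target (fcomp v e)

/-- `𝒩(u, W) ≥ 0` almost everywhere. -/
def ConformalData.SubsolutionIneq (D : ConformalData n M) (u : M → ℝ) (W : VField n M) : Prop :=
  AEOn fun e x => 0 ≤ D.lichnerowicz u W e x

/-- `u` is a global subsolution: a positive `W^{2,p}_loc` function with `𝒩(u, W(v)) ≥ 0` for all
`v ∈ L^p_loc` with `u ≤ v`. -/
def ConformalData.IsGlobalSubsolution (D : ConformalData n M) (A : AsymptoticEnds n M) (p δ : ℝ)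
    (u : M → ℝ) : Prop :=
  (∀ q, 0 < u q) ∧
  (∀ e ∈ Charts n M, MemWLoc 2 (ENNReal.ofReal p) e.target (fcomp u e)) ∧
  ∀ (v : M → ℝ) (W : VField n M), MemLpLoc n p v →
    AEOn (n := n) (M := M) (fun e x => u (e.symm x) ≤ v (e.symm x)) →
    D.SolvesVector A p δ v W → D.SubsolutionIneq u W

end Manifold

end AEConstraint

end

/-! Put `φ = 1 + ψ` and `s = N - 2 = 4/(n-2)`. The conformal change of scalar curvature reads `R(φ^s
g) = φ^(-s) (R_g - (n-1) s φ⁻¹ Δ_g φ)`, and `(n-1) s = 1/c_n`. Since `c_n (n-1)/n = b_n`,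
prescribing `R(φ^s g) = -((n-1)/n) τ²` is the same as `Δ_g φ - c_n R_g φ = b_n τ² φ^(N-1)`. The left
side is linear in `φ`, hence `𝒩(αφ, W) = b_n τ² φ^(N-1) (α - α^(N-1)) + c_n |σ + 𝒟W|² (αφ)^(-N-1) +
c_n ρ (αφ)^(-N/2)`. The first term is nonnegative because `0 < α ≤ 1` and `N - 1 ≥ 1`. The vector
field enters only through a square, so the inequality holds whatever `W` is.

The labour lies in the conformal formula for a metric and a factor of class `W^{2,p}_loc`, where all
derivatives are weak and determined only almost everywhere. The product rule (`IsWeakPartial.mul`)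
and the chain rule (`IsWeakPartial.comp_of_pos`) give the first and second derivatives of `φ^s
g_{ij}` almost everywhere. At each good point the formula is then an identity between finite sums
(`scalarCurvAt_conformal`, `scalarCurvAt_rpow_conformal`) in which derivatives are mere arrays of
numbers. Since `p > n ≥ 3`, the exponents `3` and `3/2` suffice for all local integrability.
`scalarCurv_rpow_mul_ae` joins the two halves, and `ConformalData.subsolutionIneq_of_hasScalarCurv`
draws the conclusion. -/

namespace AEConstraint

/-! ### Weak partial derivatives: uniqueness and linearity -/

section WeakPartial

variable {n : ℕ} {Ω : Set (Euc n)} {i : Fin n} {f f' h h' : Euc n → ℝ}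

/-- The partial derivative of a smooth function in the `i`-th direction. -/
noncomputable abbrev partialDeriv (i : Fin n) (φ : Euc n → ℝ) (x : Euc n) : ℝ :=
  fderiv ℝ φ x (EuclideanSpace.single i 1)

theorem tsupport_partialDeriv_subset (φ : Euc n → ℝ) :
    tsupport (partialDeriv i φ) ⊆ tsupport φ :=
  tsupport_fderiv_apply_subset ℝ _

theorem continuous_partialDeriv {φ : Euc n → ℝ} (hφ : ContDiff ℝ ∞ φ) :
    Continuous (partialDeriv i φ) :=
  (hφ.continuous_fderiv (by simp)).clm_apply continuous_const

theorem hasCompactSupport_partialDeriv {φ : Euc n → ℝ} (hc : HasCompactSupport φ) :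
    HasCompactSupport (partialDeriv i φ) :=
  hc.of_isClosed_subset (isClosed_tsupport _) (tsupport_partialDeriv_subset φ)

theorem partialDeriv_mul {φ χ : Euc n → ℝ} (hφ : ContDiff ℝ ∞ φ) (hχ : ContDiff ℝ ∞ χ)
    (x : Euc n) :
    partialDeriv i (fun y => φ y * χ y) x = φ x * partialDeriv i χ x + χ x * partialDeriv i φ x := by
  have := fderiv_fun_mul (hφ.differentiable (by simp) x) (hχ.differentiable (by simp) x)
  simp [partialDeriv, this]

theorem _root_.MeasureTheory.LocallyIntegrableOn.integrable_mul_of_tsupport_subset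
    (hf : LocallyIntegrableOn f Ω) {φ : Euc n → ℝ} (hφ : Continuous φ)
    (hc : HasCompactSupport φ) (hs : tsupport φ ⊆ Ω) : Integrable fun x => f x * φ x := by
  have h1 : IntegrableOn (fun x => f x * φ x) (tsupport φ) :=
    (hf.integrableOn_compact_subset hs hc).mul_continuousOn hφ.continuousOn hc
  refine (integrableOn_iff_integrable_of_support_subset ?_).1 h1
  intro x hx
  exact subset_tsupport φ (right_ne_zero_of_mul hx)

theorem mul_ae_eq_of_tsupport_subset (hΩ : IsOpen Ω) (hf : f =ᵐ[volume.restrict Ω] f')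
    {φ : Euc n → ℝ} (hs : tsupport φ ⊆ Ω) :
    (fun x => f x * φ x) =ᵐ[volume] fun x => f' x * φ x := by
  filter_upwards [(ae_restrict_iff' hΩ.measurableSet).1 hf] with x hx
  by_cases hxΩ : x ∈ Ω
  · rw [hx hxΩ]
  · rw [image_eq_zero_of_notMem_tsupport fun h => hxΩ (hs h)]; simp

theorem _root_.MeasureTheory.LocallyIntegrableOn.congr_ae (hΩ : IsOpen Ω)
    (hf : LocallyIntegrableOn f Ω) (hff' : f =ᵐ[volume.restrict Ω] f') :
    LocallyIntegrableOn f' Ω := by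
  rw [locallyIntegrableOn_iff hΩ.isLocallyClosed] at hf ⊢
  exact fun K hK hKc => (hf K hK hKc).congr_fun_ae (ae_restrict_of_ae_restrict_of_subset hK hff')

theorem IsWeakPartial.congr (hΩ : IsOpen Ω) (hf : IsWeakPartial Ω i f h)
    (hff' : f =ᵐ[volume.restrict Ω] f') (hhh' : h =ᵐ[volume.restrict Ω] h') :
    IsWeakPartial Ω i f' h' := by
  refine ⟨hf.1.congr_ae hΩ hff', hf.2.1.congr_ae hΩ hhh', fun φ hφ hc hs => ?_⟩
  rw [← integral_congr_ae (mul_ae_eq_of_tsupport_subset hΩ hff'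
      ((tsupport_partialDeriv_subset (i := i) φ).trans hs)),
    ← integral_congr_ae (mul_ae_eq_of_tsupport_subset hΩ hhh' hs)]
  exact hf.2.2 φ hφ hc hs

/-- The fundamental lemma of the calculus of variations. As `weakPartial` is an arbitrary choice,
this uniqueness is what allows it to be computed from any exhibited weak derivative. -/
theorem IsWeakPartial.ae_eq (hΩ : IsOpen Ω) (hf : IsWeakPartial Ω i f h)
    (hf' : IsWeakPartial Ω i f h') : h =ᵐ[volume.restrict Ω] h' := by
  have := hΩ.ae_eq_zero_of_integral_contDiff_smul_eq_zero (μ := volume) (f := h - h')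
    (hf.2.1.sub hf'.2.1) fun φ hφ hc hs => by
      have h1 := hf.2.2 φ hφ hc hs
      have h2 := hf'.2.2 φ hφ hc hs
      have h3 := integral_sub (hf.2.1.integrable_mul_of_tsupport_subset hφ.continuous hc hs)
        (hf'.2.1.integrable_mul_of_tsupport_subset hφ.continuous hc hs)
      calc _ = ∫ x, h x * φ x - h' x * φ x :=
            integral_congr_ae (.of_forall fun x => by
              simp only [Pi.sub_apply, smul_eq_mul]; ring)
        _ = 0 := by rw [h3]; linarith
  refine (ae_restrict_iff' hΩ.measurableSet).2 (this.mono fun x hx hxΩ => ?_)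
  simpa [sub_eq_zero] using hx hxΩ

theorem isWeakPartial_weakPartial (hf : ∃ h, IsWeakPartial Ω i f h) :
    IsWeakPartial Ω i f (weakPartial Ω i f) := by
  rw [weakPartial, dif_pos hf]
  exact hf.choose_spec

theorem IsWeakPartial.weakPartial_ae_eq (hΩ : IsOpen Ω) (hf : IsWeakPartial Ω i f h) :
    weakPartial Ω i f =ᵐ[volume.restrict Ω] h :=
  (isWeakPartial_weakPartial ⟨h, hf⟩).ae_eq hΩ hf

theorem IsWeakPartial.add (hf : IsWeakPartial Ω i f h) (hf' : IsWeakPartial Ω i f' h') :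
    IsWeakPartial Ω i (fun x => f x + f' x) (fun x => h x + h' x) := by
  refine ⟨hf.1.add hf'.1, hf.2.1.add hf'.2.1, fun φ hφ hc hs => ?_⟩
  have hs' := (tsupport_partialDeriv_subset (i := i) φ).trans hs
  have hc' := hasCompactSupport_partialDeriv (i := i) hc
  have hφ' := continuous_partialDeriv (i := i) hφ
  simp_rw [add_mul]
  rw [integral_add (hf.1.integrable_mul_of_tsupport_subset hφ' hc' hs')
      (hf'.1.integrable_mul_of_tsupport_subset hφ' hc' hs'),
    integral_add (hf.2.1.integrable_mul_of_tsupport_subset hφ.continuous hc hs)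
      (hf'.2.1.integrable_mul_of_tsupport_subset hφ.continuous hc hs),
    hf.2.2 φ hφ hc hs, hf'.2.2 φ hφ hc hs, neg_add]

theorem IsWeakPartial.const_mul (c : ℝ) (hf : IsWeakPartial Ω i f h) :
    IsWeakPartial Ω i (fun x => c * f x) (fun x => c * h x) := by
  refine ⟨hf.1.smul c, hf.2.1.smul c, fun φ hφ hc hs => ?_⟩
  simp_rw [mul_assoc, integral_const_mul, hf.2.2 φ hφ hc hs, mul_neg]

theorem integral_partialDeriv_eq_zero {φ : Euc n → ℝ} (hφ : ContDiff ℝ ∞ φ)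
    (hc : HasCompactSupport φ) : ∫ x, partialDeriv i φ x = 0 := by
  have h1 : Integrable fun x => (1 : ℝ) * partialDeriv i φ x := by
    simpa using (continuous_partialDeriv hφ).integrable_of_hasCompactSupport
      (hasCompactSupport_partialDeriv hc)
  have h2 : Integrable fun x => (1 : ℝ) * φ x := by
    simpa using hφ.continuous.integrable_of_hasCompactSupport hc
  have := integral_mul_fderiv_eq_neg_fderiv_mul_of_integrable (by simp) h1 h2
    (fun x _ => differentiableAt_const _) (fun x _ => hφ.differentiable (by simp) x)
  simpa using this

theorem isWeakPartial_const (c : ℝ) : IsWeakPartial Ω i (fun _ => c) (fun _ => 0) := by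
  refine ⟨(locallyIntegrable_const c).locallyIntegrableOn _,
    (locallyIntegrable_const 0).locallyIntegrableOn _, fun φ hφ hc _ => ?_⟩
  rw [integral_const_mul]
  simpa using Or.inr (integral_partialDeriv_eq_zero hφ hc)

/-- A locally integrable function with a weak derivative, multiplied by a test function, has a weak
derivative on the whole space. -/
theorem IsWeakPartial.cutoff_mul (hf : IsWeakPartial Ω i f h) {χ : Euc n → ℝ}
    (hχ : ContDiff ℝ ∞ χ) (hχc : HasCompactSupport χ) (hχs : tsupport χ ⊆ Ω) :
    IsWeakPartial Set.univ i (fun x => f x * χ x)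
      (fun x => h x * χ x + f x * partialDeriv i χ x) := by
  have hχs' := (tsupport_partialDeriv_subset (i := i) χ).trans hχs
  have hχc' := hasCompactSupport_partialDeriv (i := i) hχc
  have hχ' := continuous_partialDeriv (i := i) hχ
  have i1 := hf.1.integrable_mul_of_tsupport_subset hχ.continuous hχc hχs
  have i2 := (hf.2.1.integrable_mul_of_tsupport_subset hχ.continuous hχc hχs).add
    (hf.1.integrable_mul_of_tsupport_subset hχ' hχc' hχs')
  refine ⟨i1.locallyIntegrable.locallyIntegrableOn _, i2.locallyIntegrable.locallyIntegrableOn _,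
    fun φ hφ hc hs => ?_⟩
  have hps : tsupport (fun x => χ x * φ x) ⊆ Ω := (tsupport_mul_subset_left).trans hχs
  have hpc : HasCompactSupport (fun x => χ x * φ x) := hχc.mul_right
  -- `φ` may have support outside `Ω`, but `χ φ` is an admissible test function.
  have key := hf.2.2 (fun x => χ x * φ x) (hχ.mul hφ) hpc hps
  have hq : HasCompactSupport (fun x => partialDeriv i χ x * φ x) := hχc'.mul_right
  have j1 := hf.1.integrable_mul_of_tsupport_subset
    (continuous_partialDeriv (i := i) (hχ.mul hφ)) (hasCompactSupport_partialDeriv hpc)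
    ((tsupport_partialDeriv_subset (i := i) _).trans hps)
  have j2 : Integrable fun x => f x * (partialDeriv i χ x * φ x) := hf.1.integrable_mul_of_tsupport_subset (hχ'.mul hφ.continuous) hq
    ((tsupport_mul_subset_left).trans hχs')
  have j3 : Integrable fun x => h x * (χ x * φ x) := hf.2.1.integrable_mul_of_tsupport_subset (hχ.continuous.mul hφ.continuous) hpc hps
  calc ∫ x, f x * χ x * partialDeriv i φ x
      = ∫ x, f x * partialDeriv i (fun y => χ y * φ y) x - f x * (partialDeriv i χ x * φ x) := by
        congr 1 with x
        rw [partialDeriv_mul hχ hφ]; ring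
    _ = -(∫ x, h x * (χ x * φ x)) - ∫ x, f x * (partialDeriv i χ x * φ x) := by
        rw [integral_sub j1 j2, key]
    _ = -∫ x, h x * (χ x * φ x) + f x * (partialDeriv i χ x * φ x) := by
        rw [integral_add j3 j2]; ring
    _ = _ := by
        congr 2 with x
        ring

end WeakPartial

/-! ### The product rule for weak derivatives -/

section Correlation

variable {n : ℕ} {i : Fin n} {p q : ℝ≥0∞} {f g h : Euc n → ℝ}

/-- The cross-correlation `y ↦ ∫ f(x) g(x + y) dx`. -/
noncomputable def crossCorr (f g : Euc n → ℝ) (y : Euc n) : ℝ := ∫ x, f x * g (x + y)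

theorem crossCorr_neg (f g : Euc n → ℝ) (y : Euc n) : crossCorr f g (-y) = crossCorr g f y := by
  rw [crossCorr, ← integral_add_right_eq_self _ y]
  simp [crossCorr, mul_comm]

/-- Translation acts continuously on `L^q` for `q < ∞`, and pairing with a fixed element of `L^p` is
continuous. -/
theorem _root_.MeasureTheory.MemLp.continuous_crossCorr [Fact (1 ≤ p)] [Fact (1 ≤ q)]
    [p.HolderConjugate q] (hq : q ≠ ⊤) (hf : MemLp f p) (hg : MemLp g q) :
    Continuous (crossCorr f g) := by
  have hmp (y : Euc n) : MeasurePreserving (ContinuousMap.id (Euc n) + ContinuousMap.const (Euc n) y)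
      volume volume :=
    measurePreserving_add_right volume y
  have hcont : Continuous fun y : Euc n =>
      Lp.compMeasurePreserving (ContinuousMap.id (Euc n) + ContinuousMap.const (Euc n) y) (hmp y)
        (hg.toLp g) :=
    Continuous.compMeasurePreservingLp continuous_const
      (continuous_const.add ContinuousMap.continuous_const') hmp hq
  have := (((ContinuousLinearMap.mul ℝ ℝ).lpPairing volume p q (hf.toLp f)).continuous.comp hcont)
  convert this using 1
  funext y
  rw [Function.comp_apply, ContinuousLinearMap.lpPairing_eq_integral]
  refine integral_congr_ae ?_
  have h1 := Lp.coeFn_compMeasurePreserving (hg.toLp g) (hmp y)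
  have h2 := (hmp y).quasiMeasurePreserving.ae_eq_comp hg.coeFn_toLp
  filter_upwards [h1, h2, hf.coeFn_toLp] with x e1 e2 e3
  rw [e1, e2, e3]
  rfl

theorem integral_mul_crossCorr [Fact (1 ≤ p)] [Fact (1 ≤ q)]
    [p.HolderConjugate q] (hq : q ≠ ⊤) (hf : MemLp f p) (hg : MemLp g q)
    {θ : Euc n → ℝ} (hθ : Continuous θ) (hc : HasCompactSupport θ) :
    ∫ y, θ y * crossCorr f g y = ∫ x, f x * ∫ y, g (x + y) * θ y := by
  have hmeas : AEStronglyMeasurable (fun z : Euc n × Euc n => θ z.1 * (f z.2 * g (z.2 + z.1)))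
      (volume.prod volume) := by
    have hqm : Measure.QuasiMeasurePreserving (fun z : Euc n × Euc n => z.2 + z.1)
        (volume.prod volume) volume := by
      have := (Measure.quasiMeasurePreserving_snd (μ := (volume : Measure (Euc n)))
        (ν := (volume : Measure (Euc n)))).comp
        (measurePreserving_prod_add volume volume).quasiMeasurePreserving
      simpa [Function.comp_def, add_comm] using this
    exact (hθ.comp continuous_fst).aestronglyMeasurable.mul
      ((hf.1.comp_quasiMeasurePreserving Measure.quasiMeasurePreserving_snd).mul
        (hg.1.comp_quasiMeasurePreserving hqm))
  have hshift (y : Euc n) : MemLp (fun x => g (x + y)) q :=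
    hg.comp_measurePreserving (measurePreserving_add_right volume y)
  have hint : Integrable (fun z : Euc n × Euc n => θ z.1 * (f z.2 * g (z.2 + z.1)))
      (volume.prod volume) := by
    rw [integrable_prod_iff hmeas]
    refine ⟨.of_forall fun y => ((hf.integrable_mul (hshift y)).const_mul (θ y)), ?_⟩
    -- Fubini's integrability condition: the inner integral of the norms is `|θ|` times the
    -- correlation of `|f|` and `|g|`, which is continuous with compact support.
    have hcont : Continuous fun y => |θ y| * crossCorr (fun x => |f x|) (fun x => |g x|) y :=
      hθ.abs.mul (hf.abs.continuous_crossCorr hq hg.abs)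
    have hcs : HasCompactSupport
        fun y => |θ y| * crossCorr (fun x => |f x|) (fun x => |g x|) y :=
      HasCompactSupport.mul_right (hc.comp_left abs_zero)
    refine (hcont.integrable_of_hasCompactSupport hcs).congr (.of_forall fun y => ?_)
    simp only [crossCorr, norm_mul, Real.norm_eq_abs]
    rw [integral_const_mul]
  calc ∫ y, θ y * crossCorr f g y = ∫ y, ∫ x, θ y * (f x * g (x + y)) := by
        simp_rw [crossCorr, integral_const_mul]
    _ = ∫ x, ∫ y, θ y * (f x * g (x + y)) := integral_integral_swap hint
    _ = _ := by
        congr 1 with x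
        rw [← integral_const_mul]
        congr 1 with y
        ring

/-- A derivative in the shift variable falls on the second factor: after Fubini, the translate `ρ(·
- x)` is a test function for `g`. -/
theorem IsWeakPartial.integral_partialDeriv_mul_crossCorr [Fact (1 ≤ p)] [Fact (1 ≤ q)]
    [p.HolderConjugate q] (hq : q ≠ ⊤) (hf : MemLp f p) (hg : MemLp g q) (hh : MemLp h q)
    (hgh : IsWeakPartial Set.univ i g h) {ρ : Euc n → ℝ} (hρ : ContDiff ℝ ∞ ρ)
    (hc : HasCompactSupport ρ) :
    ∫ y, partialDeriv i ρ y * crossCorr f g y = - ∫ y, ρ y * crossCorr f h y := by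
  rw [integral_mul_crossCorr hq hf hg (continuous_partialDeriv hρ)
      (hasCompactSupport_partialDeriv hc), integral_mul_crossCorr hq hf hh hρ.continuous hc,
    ← integral_neg]
  congr 1 with x
  have key := hgh.2.2 (fun z => ρ (z - x)) (hρ.comp (contDiff_id.sub contDiff_const))
    (hc.comp_homeomorph (Homeomorph.subRight x)) (Set.subset_univ _)
  rw [← integral_add_right_eq_self _ x, ← integral_add_right_eq_self (fun z => h z * _) x] at key
  simp only [add_sub_cancel_right, fderiv_comp_sub] at key
  simp only [partialDeriv, add_comm x, key, mul_neg]

/-- Integration by parts for two Sobolev functions, without mollifiers. The distributional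
derivative of the correlation of `u` and `v` can be put on either factor, with opposite signs. So
the sum of the correlations of `u, k` and of `h, v` is zero as a distribution; being continuous, it
vanishes at shift `0`, which is the claim. -/
theorem IsWeakPartial.integral_mul_add_mul_eq_zero [Fact (1 ≤ p)] [Fact (1 ≤ q)]
    [p.HolderConjugate q] (hp : p ≠ ⊤) (hq : q ≠ ⊤) {u v k : Euc n → ℝ}
    (hu : MemLp u p) (hh : MemLp h p) (hv : MemLp v q) (hk : MemLp k q)
    (huh : IsWeakPartial Set.univ i u h) (hvk : IsWeakPartial Set.univ i v k) :
    ∫ x, (u x * k x + h x * v x) = 0 := by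
  have c1 := hu.continuous_crossCorr hq hk
  have c2 := hh.continuous_crossCorr hq hv
  have key : (fun y => crossCorr u k y + crossCorr h v y) =ᵐ[volume] fun _ => (0 : ℝ) := by
    refine ae_eq_zero_of_integral_contDiff_smul_eq_zero (c1.add c2).locallyIntegrable
      fun ρ hρ hc => ?_
    have e1 := hvk.integral_partialDeriv_mul_crossCorr hq hu hv hk hρ hc
    -- Exchanging the factors of a correlation reflects the shift, so the reflected test function
    -- `ρ(-y)` is used; its derivative supplies the opposite sign.
    have e2 := huh.integral_partialDeriv_mul_crossCorr (p := q) hp hv hu hh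
      (ρ := fun y => ρ (-y)) (hρ.comp contDiff_neg) (hc.comp_homeomorph (Homeomorph.neg _))
    rw [← integral_neg_eq_self, ← integral_neg_eq_self (fun y => ρ (-y) * _)] at e2
    have e3 (x : Euc n) : fderiv ℝ (fun y => ρ (-y)) (-x) = -fderiv ℝ ρ x := by
      have h1 : HasFDerivAt ρ (fderiv ℝ ρ x) (-(-x)) := by
        rw [neg_neg]; exact (hρ.differentiable (by simp) x).hasFDerivAt
      have h2 := h1.comp (-x) (hasFDerivAt_id (-x)).neg
      have h3 := h2.fderiv
      simp only [Function.comp_def] at h3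
      rw [h3]
      ext v
      simp
    simp only [partialDeriv, e3, neg_neg, crossCorr_neg, neg_apply, neg_mul, integral_neg] at e2
    simp only [smul_eq_mul, mul_add]
    have j1 : Integrable fun y => ρ y * crossCorr u k y :=
      (hρ.continuous.mul c1).integrable_of_hasCompactSupport hc.mul_right
    have j2 : Integrable fun y => ρ y * crossCorr h v y :=
      (hρ.continuous.mul c2).integrable_of_hasCompactSupport hc.mul_right
    rw [integral_add j1 j2]
    simp only [partialDeriv] at e1
    linarith
  have h0 := congr_fun ((c1.add c2).ae_eq_iff_eq volume continuous_const |>.1 key) 0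
  have j1 : Integrable fun x => u x * k x := hu.integrable_mul hk
  have j2 : Integrable fun x => h x * v x := hh.integrable_mul hv
  rw [integral_add j1 j2]
  simpa [crossCorr] using h0

end Correlation

/-! ### Local Lebesgue spaces, cutoffs and the product rule -/

section LocalLp

variable {n : ℕ} {Ω : Set (Euc n)} {i : Fin n} {p q r : ℝ≥0∞} {f f' g h k : Euc n → ℝ}

/-- `f ∈ L^p_loc(Ω)`. -/
def MemLpOnCompacts (p : ℝ≥0∞) (Ω : Set (Euc n)) (f : Euc n → ℝ) : Prop :=
  ∀ C ⊆ Ω, IsCompact C → MemLp f p (volume.restrict C)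

namespace MemLpOnCompacts

theorem locallyIntegrableOn (hΩ : IsOpen Ω) (hp : 1 ≤ p) (hf : MemLpOnCompacts p Ω f) :
    LocallyIntegrableOn f Ω := by
  rw [locallyIntegrableOn_iff hΩ.isLocallyClosed]
  intro K hK hKc
  have : IsFiniteMeasure (volume.restrict K) := isFiniteMeasure_restrict.2 hKc.measure_ne_top
  exact (hf K hK hKc).integrable hp

theorem mono_exponent (hf : MemLpOnCompacts p Ω f) (hqp : q ≤ p) : MemLpOnCompacts q Ω f := by
  intro K hK hKc
  have : IsFiniteMeasure (volume.restrict K) := isFiniteMeasure_restrict.2 hKc.measure_ne_top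
  exact (hf K hK hKc).mono_exponent hqp

theorem mul [p.HolderTriple q r] (hf : MemLpOnCompacts p Ω f) (hg : MemLpOnCompacts q Ω g) :
    MemLpOnCompacts r Ω fun x => f x * g x :=
  fun K hK hKc => (hg K hK hKc).mul (hf K hK hKc)

theorem add (hf : MemLpOnCompacts p Ω f) (hg : MemLpOnCompacts p Ω g) :
    MemLpOnCompacts p Ω fun x => f x + g x :=
  fun K hK hKc => (hf K hK hKc).add (hg K hK hKc)

theorem const_mul (hf : MemLpOnCompacts p Ω f) (c : ℝ) :
    MemLpOnCompacts p Ω fun x => c * f x :=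
  fun K hK hKc => (hf K hK hKc).const_mul c

theorem congr_ae (hf : MemLpOnCompacts p Ω f) (h : f =ᵐ[volume.restrict Ω] f') :
    MemLpOnCompacts p Ω f' :=
  fun K hK hKc => (memLp_congr_ae (ae_restrict_of_ae_restrict_of_subset hK h)).1 (hf K hK hKc)

end MemLpOnCompacts

theorem _root_.ContinuousOn.memLpOnCompacts (hf : ContinuousOn f Ω) : MemLpOnCompacts p Ω f := by
  refine MemLpOnCompacts.mono_exponent (p := ⊤) (fun K hK hKc => ?_) le_top
  obtain ⟨C, hC⟩ := hKc.exists_bound_of_continuousOn (hf.mono hK)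
  exact memLp_top_of_bound ((hf.mono hK).aestronglyMeasurable hKc.measurableSet) C
    ((ae_restrict_iff' hKc.measurableSet).2 (.of_forall hC))

theorem MemLpOnCompacts.memLp_mul (hf : MemLpOnCompacts p Ω f) {χ : Euc n → ℝ}
    (hχ : Continuous χ) (hc : HasCompactSupport χ) (hs : tsupport χ ⊆ Ω) :
    MemLp (fun x => f x * χ x) p := by
  have h1 : MemLp (fun x => f x * χ x) p (volume.restrict (tsupport χ)) :=
    (hχ.continuousOn.memLpOnCompacts (p := ⊤) (tsupport χ) subset_rfl hc).mul (hf _ hs hc)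
  rw [← memLp_indicator_iff_restrict (isClosed_tsupport χ).measurableSet] at h1
  have h2 : (tsupport χ).indicator (fun x => f x * χ x) = fun x => f x * χ x :=
    Set.indicator_eq_self.2 fun x hx => subset_tsupport χ (right_ne_zero_of_mul hx)
  rwa [h2] at h1

/-- Equality with `1` near each point of `K`, not just on `K`, makes the derivative of the cutoff
vanish on `K` too. -/
theorem exists_contDiff_one_nhds_of_isCompact {K : Set (Euc n)} (hK : IsCompact K)
    (hΩ : IsOpen Ω) (hKΩ : K ⊆ Ω) :
    ∃ χ : Euc n → ℝ, ContDiff ℝ ∞ χ ∧ HasCompactSupport χ ∧ tsupport χ ⊆ Ω ∧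
      ∀ x ∈ K, ∀ᶠ y in nhds x, χ y = 1 := by
  obtain ⟨L, hL, hKL, hLΩ⟩ := exists_compact_between hK hΩ hKΩ
  obtain ⟨χ, h1, h0, -⟩ := exists_contMDiffMap_one_nhds_of_subset_interior 𝓘(ℝ, Euc n) (n := ⊤)
    hK.isClosed hKL
  have hsub : tsupport χ ⊆ L :=
    closure_minimal (fun x hx => by_contra fun hxL => hx (h0 x hxL)) hL.isClosed
  exact ⟨χ, χ.contMDiff.contDiff, hL.of_isClosed_subset (isClosed_tsupport _) hsub,
    hsub.trans hLΩ, fun x hx => h1.filter_mono (nhds_le_nhdsSet hx)⟩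

/-- The product rule for weak derivatives, with conjugate exponents. -/
theorem IsWeakPartial.mul [p.HolderConjugate q] (hp : p ≠ ⊤) (hq : q ≠ ⊤) (hΩ : IsOpen Ω)
    (hfh : IsWeakPartial Ω i f h) (hgk : IsWeakPartial Ω i g k)
    (hf : MemLpOnCompacts p Ω f) (hh : MemLpOnCompacts p Ω h)
    (hg : MemLpOnCompacts q Ω g) (hk : MemLpOnCompacts q Ω k) :
    IsWeakPartial Ω i (fun x => f x * g x) (fun x => f x * k x + h x * g x) := by
  have hp1 : 1 ≤ p := ENNReal.HolderConjugate.one_le p q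
  have hq1 : 1 ≤ q := ENNReal.HolderConjugate.one_le q p
  have : Fact (1 ≤ p) := ⟨hp1⟩
  have : Fact (1 ≤ q) := ⟨hq1⟩
  have l1 : LocallyIntegrableOn (fun x => f x * g x) Ω :=
    (hf.mul (r := 1) hg).locallyIntegrableOn hΩ le_rfl
  have l2 : LocallyIntegrableOn (fun x => f x * k x + h x * g x) Ω :=
    ((hf.mul (r := 1) hk).add (hh.mul hg)).locallyIntegrableOn hΩ le_rfl
  refine ⟨l1, l2, fun φ hφ hc hs => ?_⟩
  obtain ⟨χ, hχ, hχc, hχs, hχ1⟩ := exists_contDiff_one_nhds_of_isCompact hc hΩ hs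
  have hφ' := continuous_partialDeriv (i := i) hφ
  have hχ' := continuous_partialDeriv (i := i) hχ
  have hφs' := (tsupport_partialDeriv_subset (i := i) φ).trans hs
  have hχs' := (tsupport_partialDeriv_subset (i := i) χ).trans hχs
  have hφc' := hasCompactSupport_partialDeriv (i := i) hc
  have hχc' := hasCompactSupport_partialDeriv (i := i) hχc
  -- The functions `f χ` and `g φ` have weak derivatives on all of `ℝⁿ`. On the support of `φ` one
  -- has `χ = 1` and `∂ᵢχ = 0`, so the global identity for them is the local product rule tested
  -- against `φ`.
  have key := IsWeakPartial.integral_mul_add_mul_eq_zero hp hq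
    (hf.memLp_mul hχ.continuous hχc hχs)
    ((hh.memLp_mul hχ.continuous hχc hχs).add (hf.memLp_mul hχ' hχc' hχs'))
    (hg.memLp_mul hφ.continuous hc hs)
    ((hk.memLp_mul hφ.continuous hc hs).add (hg.memLp_mul hφ' hφc' hφs'))
    (hfh.cutoff_mul hχ hχc hχs) (hgk.cutoff_mul hφ hc hs)
  rw [eq_neg_iff_add_eq_zero, ← integral_add (l1.integrable_mul_of_tsupport_subset hφ' hφc' hφs')
    (l2.integrable_mul_of_tsupport_subset hφ.continuous hc hs), ← key]
  congr 1 with x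
  by_cases hx : x ∈ tsupport φ
  · have e1 : χ x = 1 := (hχ1 x hx).self_of_nhds
    have e2 : fderiv ℝ χ x = 0 := by
      rw [(show χ =ᶠ[nhds x] fun _ => 1 from hχ1 x hx).fderiv_eq, fderiv_fun_const]; rfl
    simp only [partialDeriv, Pi.add_apply, e1, e2, zero_apply]
    ring
  · have e1 : φ x = 0 := image_eq_zero_of_notMem_tsupport hx
    have e2 : partialDeriv i φ x = 0 :=
      image_eq_zero_of_notMem_tsupport fun h => hx (tsupport_partialDeriv_subset φ h)
    simp only [partialDeriv, Pi.add_apply] at e2 ⊢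
    simp only [e1, e2]
    ring

end LocalLp

/-! ### The chain rule for weak derivatives -/

section ChainRule

open Polynomial

theorem _root_.Polynomial.exists_derivative_eq (Q : ℝ[X]) : ∃ P : ℝ[X], derivative P = Q := by
  induction Q using Polynomial.induction_on' with
  | add a b ha hb =>
    obtain ⟨P, hP⟩ := ha
    obtain ⟨P', hP'⟩ := hb
    exact ⟨P + P', by simp [hP, hP']⟩
  | monomial m c =>
    refine ⟨monomial (m + 1) (c / (m + 1)), ?_⟩
    rw [derivative_monomial, Nat.add_sub_cancel]
    congr 1
    push_cast
    field_simp

/-- `C¹` approximation by polynomials on a compact interval. -/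
theorem exists_polynomial_near_of_hasDerivAt {f f' : ℝ → ℝ} {a b : ℝ}
    (hf : ∀ y ∈ Set.Icc a b, HasDerivAt f (f' y) y) (hf' : ContinuousOn f' (Set.Icc a b))
    {ε : ℝ} (hε : 0 < ε) :
    ∃ P : ℝ[X], ∀ y ∈ Set.Icc a b,
      |P.eval y - f y| ≤ ε * (b - a) ∧ |(derivative P).eval y - f' y| ≤ ε := by
  -- Weierstrass is applied to the derivative. A primitive, normalised to agree with `f` at `a`, is
  -- then close to `f` by the mean value inequality.
  obtain ⟨Q, hQ⟩ := exists_polynomial_near_of_continuousOn a b f' hf' ε hε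
  obtain ⟨P₀, rfl⟩ := Q.exists_derivative_eq
  refine ⟨P₀ + C (f a - P₀.eval a), fun y hy => ⟨?_, by simpa using (hQ y hy).le⟩⟩
  have ha : a ∈ Set.Icc a b := ⟨le_rfl, hy.1.trans hy.2⟩
  have := (convex_Icc a b).norm_image_sub_le_of_norm_hasDerivWithin_le
    (f := fun y => P₀.eval y - f y) (C := ε)
    (fun z hz => ((P₀.hasDerivAt z).sub (hf z hz)).hasDerivWithinAt)
    (fun z hz => (hQ z hz).le) ha hy
  rw [Real.norm_eq_abs, Real.norm_eq_abs, abs_of_nonneg (sub_nonneg.2 hy.1)] at this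
  calc _ = |P₀.eval y - f y - (P₀.eval a - f a)| := by
        simp only [eval_add, eval_C]
        congr 1
        ring
    _ ≤ ε * (y - a) := this
    _ ≤ ε * (b - a) := by gcongr; exact hy.2

variable {n : ℕ} {Ω : Set (Euc n)} {i : Fin n} {p q : ℝ≥0∞} {F h : Euc n → ℝ}

/-- Induction on the degree by the product rule. The condition `q ≤ p` lets the derivative, locally
in `L^p`, also serve as the `L^q` factor. -/
theorem IsWeakPartial.polynomial_eval [p.HolderConjugate q] (hp : p ≠ ⊤) (hqp : q ≤ p)
    (hΩ : IsOpen Ω) (hF : ContinuousOn F Ω) (hh : MemLpOnCompacts p Ω h)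
    (hFh : IsWeakPartial Ω i F h) (P : ℝ[X]) :
    IsWeakPartial Ω i (fun x => P.eval (F x)) (fun x => (derivative P).eval (F x) * h x) := by
  induction P using Polynomial.induction_on with
  | C a => simpa using isWeakPartial_const a
  | add P Q hP hQ => simpa [add_mul] using hP.add hQ
  | monomial m a hm =>
    have hd : MemLpOnCompacts q Ω
        (fun x => (derivative (C a * X ^ m)).eval (F x) * h x) :=
      MemLpOnCompacts.mul (p := ⊤)
        ((Polynomial.continuous _).comp_continuousOn hF).memLpOnCompacts (hh.mono_exponent hqp)
    have := hFh.mul hp (ne_top_of_le_ne_top hp hqp) hΩ hm hF.memLpOnCompacts hh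
      ((Polynomial.continuous _).comp_continuousOn hF).memLpOnCompacts hd
    convert this using 2 with x x
    · simp only [eval_mul, eval_C, eval_pow, eval_X]
      ring
    · rw [pow_succ, ← mul_assoc, derivative_mul]
      simp only [eval_add, eval_mul, eval_C, eval_pow, eval_X, derivative_X, eval_one]
      ring

/-- The chain rule for the composition of a positive continuous function with a `C¹` function on
the positive half-line. -/
theorem IsWeakPartial.comp_of_pos [p.HolderConjugate q] (hp : p ≠ ⊤) (hqp : q ≤ p)
    (hΩ : IsOpen Ω) (hF : ContinuousOn F Ω) (hpos : ∀ x ∈ Ω, 0 < F x)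
    (hh : MemLpOnCompacts p Ω h) (hFh : IsWeakPartial Ω i F h) {f f' : ℝ → ℝ}
    (hf : ∀ y, 0 < y → HasDerivAt f (f' y) y) (hf' : ContinuousOn f' (Set.Ioi 0)) :
    IsWeakPartial Ω i (fun x => f (F x)) (fun x => f' (F x) * h x) := by
  have hp1 : 1 ≤ p := ENNReal.HolderConjugate.one_le p q
  have cf : ContinuousOn (fun x => f (F x)) Ω := by
    have : ContinuousOn f (Set.Ioi 0) := fun y hy => (hf y hy).continuousAt.continuousWithinAt
    exact this.comp hF hpos
  have cf' : ContinuousOn (fun x => f' (F x)) Ω := hf'.comp hF hpos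
  have l1 : LocallyIntegrableOn (fun x => f (F x)) Ω :=
    cf.memLpOnCompacts.locallyIntegrableOn hΩ hp1
  have l2 : LocallyIntegrableOn (fun x => f' (F x) * h x) Ω :=
    (MemLpOnCompacts.mul (p := ⊤) cf'.memLpOnCompacts hh).locallyIntegrableOn hΩ hp1
  refine ⟨l1, l2, fun φ hφ hc hs => ?_⟩
  have hφ' := continuous_partialDeriv (i := i) hφ
  have hφs' := (tsupport_partialDeriv_subset (i := i) φ).trans hs
  have hφc' := hasCompactSupport_partialDeriv (i := i) hc
  -- On the support of the test function, `F` takes values in a compact interval of `(0, ∞)`, where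
  -- `f` is a `C¹` limit of polynomials. For empty support any positive interval will do.
  obtain ⟨a, b, ha, hab⟩ : ∃ a b : ℝ, 0 < a ∧ ∀ x ∈ tsupport φ, F x ∈ Set.Icc a b := by
    rcases (tsupport φ).eq_empty_or_nonempty with h0 | hne
    · exact ⟨1, 1, one_pos, by simp [h0]⟩
    · obtain ⟨x₀, hx₀, h1⟩ := IsCompact.exists_isMinOn hc hne (hF.mono hs)
      obtain ⟨x₁, hx₁, h2⟩ := IsCompact.exists_isMaxOn hc hne (hF.mono hs)
      exact ⟨F x₀, F x₁, hpos _ (hs hx₀), fun x hx => ⟨h1 hx, h2 hx⟩⟩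
  have hpos' : ∀ y ∈ Set.Icc a b, 0 < y := fun y hy => ha.trans_le hy.1
  have i1 := l1.integrable_mul_of_tsupport_subset hφ' hφc' hφs'
  have i2 := l2.integrable_mul_of_tsupport_subset hφ.continuous hc hs
  have i3 := hφ'.integrable_of_hasCompactSupport (μ := volume) hφc'
  have i4 := hFh.2.1.integrable_mul_of_tsupport_subset hφ.continuous hc hs
  -- An approximation with error `ε` in the derivative has error `ε (b - a)` in the value;
  -- integrated against the test function, the total error is `ε D`.
  set D : ℝ := (b - a) * (∫ x, |partialDeriv i φ x|) + ∫ x, |h x * φ x|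
  have bound (ε : ℝ) (hε : 0 < ε) :
      |(∫ x, f (F x) * partialDeriv i φ x) + ∫ x, f' (F x) * h x * φ x| ≤ ε * D := by
    obtain ⟨P, hP⟩ := exists_polynomial_near_of_hasDerivAt (fun y hy => hf y (hpos' y hy))
      (hf'.mono hpos') hε
    have hPw := hFh.polynomial_eval hp hqp hΩ hF hh P
    have hPe := hPw.2.2 φ hφ hc hs
    have i5 := hPw.1.integrable_mul_of_tsupport_subset hφ' hφc' hφs'
    have i6 := hPw.2.1.integrable_mul_of_tsupport_subset hφ.continuous hc hs
    have e1 : (∫ x, f (F x) * partialDeriv i φ x) + ∫ x, f' (F x) * h x * φ x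
        = ∫ x, (f (F x) * partialDeriv i φ x - P.eval (F x) * partialDeriv i φ x)
          + (f' (F x) * h x * φ x - (derivative P).eval (F x) * h x * φ x) := by
      have i7 : Integrable fun x =>
          f (F x) * partialDeriv i φ x - P.eval (F x) * partialDeriv i φ x := i1.sub i5
      have i8 : Integrable fun x =>
          f' (F x) * h x * φ x - (derivative P).eval (F x) * h x * φ x := i2.sub i6
      rw [integral_add i7 i8, integral_sub i1 i5, integral_sub i2 i6]
      simp only [partialDeriv] at hPe ⊢
      linarith
    have e2 : ε * D = ∫ x, ε * ((b - a) * |partialDeriv i φ x|) + ε * |h x * φ x| := by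
      rw [integral_add ((i3.abs.const_mul _).const_mul _) (i4.abs.const_mul _),
        integral_const_mul, integral_const_mul, integral_const_mul]
      ring
    rw [e1, e2, ← Real.norm_eq_abs]
    refine norm_integral_le_of_norm_le
      (((i3.abs.const_mul _).const_mul _).add (i4.abs.const_mul _)) (.of_forall fun x => ?_)
    by_cases hx : x ∈ tsupport φ
    · obtain ⟨h1, h2⟩ := hP _ (hab x hx)
      rw [← sub_mul, mul_assoc, mul_assoc, ← sub_mul, ← mul_assoc ε]
      refine (norm_add_le _ _).trans (add_le_add ?_ ?_)
      · rw [norm_mul, Real.norm_eq_abs, Real.norm_eq_abs, abs_sub_comm]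
        gcongr
      · rw [norm_mul, Real.norm_eq_abs, Real.norm_eq_abs, abs_sub_comm]
        gcongr
    · have e1 : φ x = 0 := image_eq_zero_of_notMem_tsupport hx
      have e2 : partialDeriv i φ x = 0 :=
        image_eq_zero_of_notMem_tsupport fun h => hx (tsupport_partialDeriv_subset φ h)
      simp [e1, e2]
  have hzero : |(∫ x, f (F x) * partialDeriv i φ x) + ∫ x, f' (F x) * h x * φ x| ≤ 0 := by
    have hlim : Filter.Tendsto (fun ε : ℝ => ε * D) (nhdsWithin 0 (Set.Ioi 0)) (nhds 0) := by
      have : Continuous fun ε : ℝ => ε * D := by fun_prop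
      simpa using (this.tendsto 0).mono_left nhdsWithin_le_nhds
    exact ge_of_tendsto hlim (Filter.eventually_of_mem self_mem_nhdsWithin bound)
  exact eq_neg_of_add_eq_zero_left (abs_nonpos_iff.1 hzero)

theorem IsWeakPartial.rpow [p.HolderConjugate q] (hp : p ≠ ⊤) (hqp : q ≤ p)
    (hΩ : IsOpen Ω) (hF : ContinuousOn F Ω) (hpos : ∀ x ∈ Ω, 0 < F x)
    (hh : MemLpOnCompacts p Ω h) (hFh : IsWeakPartial Ω i F h) (s : ℝ) :
    IsWeakPartial Ω i (fun x => F x ^ s) (fun x => s * F x ^ (s - 1) * h x) :=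
  hFh.comp_of_pos hp hqp hΩ hF hpos hh
    (f := fun y => y ^ s) (f' := fun y => s * y ^ (s - 1))
    (fun _ hy => Real.hasDerivAt_rpow_const (Or.inl hy.ne'))
    (continuousOn_const.mul (continuousOn_id.rpow_const fun _ hy => Or.inl hy.ne'))

end ChainRule

/-! ### Weak derivatives of affine images and of weighted powers -/

section Sobolev

variable {n k : ℕ} {Ω : Set (Euc n)} {i j : Fin n} {p : ℝ≥0∞} {f f' F G : Euc n → ℝ}

/-- The constant `1` survives only for the empty multi-index, hence the case distinction. -/
theorem HasWeakDerivs.weakIter_affine (hΩ : IsOpen Ω) (hf : HasWeakDerivs k Ω f) (a : ℝ)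
    (β : List (Fin n)) (hβ : β.length ≤ k) :
    weakIter Ω (fun x => a * (1 + f x)) β =ᵐ[volume.restrict Ω]
      fun x => a * ((if β = [] then 1 else 0) + weakIter Ω f β x) := by
  induction β with
  | nil => simp [weakIter]
  | cons i β ih =>
    have h1 := isWeakPartial_weakPartial (hf β (by simpa using hβ) i)
    have h2 := ((isWeakPartial_const (Ω := Ω) (i := i) (if β = [] then 1 else 0)).add h1).const_mul a
    have h3 := h2.congr hΩ (ih (by simp at hβ; omega)).symm .rfl
    simpa [weakIter] using h3.weakPartial_ae_eq hΩ

theorem HasWeakDerivs.affine (hΩ : IsOpen Ω) (hf : HasWeakDerivs k Ω f) (a : ℝ) :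
    HasWeakDerivs k Ω fun x => a * (1 + f x) := by
  intro β hβ i
  have h1 := isWeakPartial_weakPartial (hf β hβ i)
  exact ⟨_, (((isWeakPartial_const (if β = [] then 1 else 0)).add h1).const_mul a).congr hΩ
    (hf.weakIter_affine hΩ a β hβ.le).symm .rfl⟩

theorem MemWLoc.affine (hΩ : IsOpen Ω) (hf : MemWLoc k p Ω f) (a : ℝ) :
    MemWLoc k p Ω fun x => a * (1 + f x) := by
  refine ⟨hf.1.affine hΩ a, fun β hβ => ?_⟩
  have h1 : MemLpOnCompacts p Ω fun x => a * ((if β = [] then 1 else 0) + weakIter Ω f β x) :=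
    ((continuousOn_const.memLpOnCompacts).add (hf.2 β hβ)).const_mul a
  exact h1.congr_ae (hf.1.weakIter_affine hΩ a β hβ).symm

theorem MemWLoc.weakPartial_affine (hΩ : IsOpen Ω) (hf : MemWLoc 2 p Ω f) (a : ℝ) (i : Fin n) :
    weakPartial Ω i (fun x => a * (1 + f x)) =ᵐ[volume.restrict Ω]
      fun x => a * weakPartial Ω i f x := by
  simpa [weakIter] using hf.1.weakIter_affine hΩ a [i] (by simp)

theorem MemWLoc.weakPartial_weakPartial_affine (hΩ : IsOpen Ω) (hf : MemWLoc 2 p Ω f) (a : ℝ)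
    (i j : Fin n) :
    weakPartial Ω i (weakPartial Ω j fun x => a * (1 + f x)) =ᵐ[volume.restrict Ω]
      fun x => a * weakPartial Ω i (weakPartial Ω j f) x := by
  simpa [weakIter] using hf.1.weakIter_affine hΩ a [i, j] (by simp)

/-- As `p > n ≥ 3`, local `L^p` functions are locally in `L^3`. Products of two of them lie in
`L^{3/2}`, the space dual to `L^3`; this is exactly what the product rule needs when a product of
first derivatives appears. -/
instance holderConjugate_three : ENNReal.HolderConjugate 3 (3 / 2) where
  inv_add_inv_eq_inv := by
    rw [ENNReal.inv_div (by simp) (by simp), ← one_div, ← ENNReal.add_div, inv_one]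
    norm_num
    exact ENNReal.div_self (by simp) (by simp)

instance holderTriple_three : ENNReal.HolderTriple 3 3 (3 / 2) where
  inv_add_inv_eq_inv := by
    rw [ENNReal.inv_div (by simp) (by simp), ← one_div, ← ENNReal.add_div]
    norm_num

theorem three_div_two_le_three : (3 / 2 : ℝ≥0∞) ≤ 3 :=
  ENNReal.div_le_of_le_mul (by norm_num)

theorem three_div_two_ne_top : (3 / 2 : ℝ≥0∞) ≠ ⊤ :=
  ne_top_of_le_ne_top (by simp) three_div_two_le_three

theorem MemWLoc.isWeakPartial (hF : MemWLoc 2 p Ω F) (i : Fin n) :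
    IsWeakPartial Ω i F (weakPartial Ω i F) :=
  isWeakPartial_weakPartial (hF.1 [] (by simp) i)

theorem MemWLoc.isWeakPartial_weakPartial (hF : MemWLoc 2 p Ω F) (i j : Fin n) :
    IsWeakPartial Ω i (weakPartial Ω j F) (weakPartial Ω i (weakPartial Ω j F)) :=
  AEConstraint.isWeakPartial_weakPartial (hF.1 [j] (by simp) i)

theorem MemWLoc.isWeakPartial_rpow_mul (hΩ : IsOpen Ω) (hp : 3 ≤ p) (hFc : ContinuousOn F Ω)
    (hpos : ∀ x ∈ Ω, 0 < F x) (hF : MemWLoc 2 p Ω F) (hG : MemWLoc 2 p Ω G) (s : ℝ)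
    (l : Fin n) :
    IsWeakPartial Ω l (fun x => F x ^ s * G x)
      (fun x => F x ^ s * weakPartial Ω l G x + s * F x ^ (s - 1) * weakPartial Ω l F x * G x) := by
  have hFl : MemLpOnCompacts 3 Ω (weakPartial Ω l F) :=
    MemLpOnCompacts.mono_exponent (hF.2 [l] (by simp)) hp
  have hc (t : ℝ) : ContinuousOn (fun x => F x ^ t) Ω :=
    hFc.rpow_const fun x hx => Or.inl (hpos x hx).ne'
  have hq : (3 / 2 : ℝ≥0∞) ≤ p := three_div_two_le_three.trans hp
  have h1 := (hF.isWeakPartial l).rpow (by simp) three_div_two_le_three hΩ hFc hpos hFl s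
  exact h1.mul (p := 3) (by simp) three_div_two_ne_top hΩ
    (hG.isWeakPartial l) (hc s).memLpOnCompacts
    (MemLpOnCompacts.mul (p := ⊤) (continuousOn_const.mul (hc _)).memLpOnCompacts hFl)
    (MemLpOnCompacts.mono_exponent (hG.2 [] (by simp)) hq)
    (MemLpOnCompacts.mono_exponent (hG.2 [l] (by simp)) hq)

theorem MemWLoc.weakPartial_rpow_mul (hΩ : IsOpen Ω) (hp : 3 ≤ p) (hFc : ContinuousOn F Ω)
    (hpos : ∀ x ∈ Ω, 0 < F x) (hF : MemWLoc 2 p Ω F) (hG : MemWLoc 2 p Ω G) (s : ℝ)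
    (l : Fin n) :
    weakPartial Ω l (fun x => F x ^ s * G x) =ᵐ[volume.restrict Ω]
      fun x => F x ^ s * weakPartial Ω l G x + s * F x ^ (s - 1) * weakPartial Ω l F x * G x :=
  (hF.isWeakPartial_rpow_mul hΩ hp hFc hpos hG s l).weakPartial_ae_eq hΩ

theorem MemWLoc.weakPartial_weakPartial_rpow_mul (hΩ : IsOpen Ω) (hp : 3 ≤ p)
    (hFc : ContinuousOn F Ω) (hpos : ∀ x ∈ Ω, 0 < F x) (hF : MemWLoc 2 p Ω F)
    (hG : MemWLoc 2 p Ω G) (s : ℝ) (k l : Fin n) :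
    weakPartial Ω k (weakPartial Ω l fun x => F x ^ s * G x) =ᵐ[volume.restrict Ω]
      fun x => F x ^ s * weakPartial Ω k (weakPartial Ω l G) x
        + s * F x ^ (s - 1) * (weakPartial Ω k F x * weakPartial Ω l G x
          + weakPartial Ω l F x * weakPartial Ω k G x
          + weakPartial Ω k (weakPartial Ω l F) x * G x)
        + s * (s - 1) * F x ^ (s - 1 - 1) * weakPartial Ω k F x * weakPartial Ω l F x * G x := by
  have hq : (3 / 2 : ℝ≥0∞) ≤ p := three_div_two_le_three.trans hp
  have hc (t : ℝ) : ContinuousOn (fun x => F x ^ t) Ω :=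
    hFc.rpow_const fun x hx => Or.inl (hpos x hx).ne'
  have F1 (i : Fin n) : MemLpOnCompacts 3 Ω (weakPartial Ω i F) :=
    MemLpOnCompacts.mono_exponent (hF.2 [i] (by simp)) hp
  have F2 : MemLpOnCompacts 3 Ω (weakPartial Ω k (weakPartial Ω l F)) :=
    MemLpOnCompacts.mono_exponent (hF.2 [k, l] (by simp)) hp
  have G0 : MemLpOnCompacts 3 Ω G := MemLpOnCompacts.mono_exponent (hG.2 [] (by simp)) hp
  have G1 (i : Fin n) : MemLpOnCompacts 3 Ω (weakPartial Ω i G) :=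
    MemLpOnCompacts.mono_exponent (hG.2 [i] (by simp)) hp
  have G2 : MemLpOnCompacts (3 / 2) Ω (weakPartial Ω k (weakPartial Ω l G)) :=
    MemLpOnCompacts.mono_exponent (hG.2 [k, l] (by simp)) hq
  have pw (t : ℝ) := (hF.isWeakPartial k).rpow (by simp) three_div_two_le_three hΩ hFc hpos (F1 k) t
  have pw' (t : ℝ) : MemLpOnCompacts 3 Ω fun x => t * F x ^ (t - 1) * weakPartial Ω k F x :=
    MemLpOnCompacts.mul (p := ⊤) (continuousOn_const.mul (hc _)).memLpOnCompacts (F1 k)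
  have a1 := (pw s).mul (by simp) three_div_two_ne_top hΩ (hG.isWeakPartial_weakPartial k l)
    (hc s).memLpOnCompacts (pw' s) ((G1 l).mono_exponent three_div_two_le_three) G2
  have a2 := (hF.isWeakPartial_weakPartial k l).mul (by simp) three_div_two_ne_top hΩ (hG.isWeakPartial k)
    (F1 l) F2 (G0.mono_exponent three_div_two_le_three)
    ((G1 k).mono_exponent three_div_two_le_three)
  -- The product `∂ₗF · G` has a derivative known only in `L^{3/2}`. Its partner `F^(s-1)` is
  -- continuous with derivative in `L^3`, so the conjugate pair applies.
  have a3 := ((pw (s - 1)).mul (by simp) three_div_two_ne_top hΩ a2 (hc _).memLpOnCompacts (pw' _)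
    ((F1 l).mul G0) (((F1 l).mul (G1 k)).add (F2.mul G0))).const_mul s
  have a4 := (a1.add a3).congr hΩ (f' := weakPartial Ω l fun x => F x ^ s * G x)
    (((Filter.EventuallyEq.of_eq (by funext x; ring)).trans
      (hF.weakPartial_rpow_mul hΩ hp hFc hpos hG s l).symm)) .rfl
  refine (a4.weakPartial_ae_eq hΩ).trans (.of_eq ?_)
  funext x
  ring

end Sobolev

/-! ### Pointwise algebra of the conformal change of the scalar curvature -/

section PointwiseAlgebra

variable {ι : Type*} [Fintype ι]

/-- Christoffel symbols from the inverse metric `h` and the derivatives `d k i j = ∂ₖ g_{ij}`. -/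
noncomputable def christoffelAt (h : ι → ι → ℝ) (d : ι → ι → ι → ℝ) (k i j : ι) : ℝ :=
  1 / 2 * ∑ l, h k l * (d i j l + d j i l - d l i j)

/-- Scalar curvature from the metric, its inverse, and first and second derivatives. -/
noncomputable def scalarCurvAt (g h : ι → ι → ℝ) (d : ι → ι → ι → ℝ)
    (dd : ι → ι → ι → ι → ℝ) : ℝ :=
  ∑ i, ∑ k, ∑ l, ∑ m, h k m * h i l *
    (1 / 2 * (dd k l i m + dd i m k l - dd k m i l - dd i l k m)
      + ∑ a, ∑ b, g a b * (christoffelAt h d a k l * christoffelAt h d b i m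
        - christoffelAt h d a k m * christoffelAt h d b i l))

/-- The part of the scalar curvature which is linear in the second derivatives. -/
def curvLinear (h : ι → ι → ℝ) (dd : ι → ι → ι → ι → ℝ) : ℝ :=
  ∑ i, ∑ k, ∑ l, ∑ m, h k m * h i l * (dd k l i m - dd k m i l)

/-- The contraction `g^{km} g^{il} g_{ab} Aᵃₖₗ Bᵇᵢₘ`. -/
def crossContraction (g h : ι → ι → ℝ) (A B : ι → ι → ι → ℝ) : ℝ :=
  ∑ i, ∑ k, ∑ l, ∑ m, h k m * h i l * ∑ a, ∑ b, g a b * (A a k l * B b i m)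

/-- The trace `g^{km} Aᵃₖₘ`. -/
def lowerTrace (h : ι → ι → ℝ) (A : ι → ι → ι → ℝ) (a : ι) : ℝ :=
  ∑ k, ∑ m, h k m * A a k m

/-- The trace `Aⁱᵢₘ`. -/
def mixedTrace (A : ι → ι → ι → ℝ) (m : ι) : ℝ := ∑ i, A i i m

theorem sum_three_rotate (F : ι → ι → ι → ℝ) :
    ∑ k, ∑ l, ∑ m, F k l m = ∑ m, ∑ k, ∑ l, F k l m :=
  (Finset.sum_congr rfl fun _ _ => Finset.sum_comm).trans Finset.sum_comm

theorem sum_five_rotate (F : ι → ι → ι → ι → ι → ℝ) :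
    ∑ i, ∑ k, ∑ l, ∑ m, ∑ a, F i k l m a = ∑ a, ∑ i, ∑ k, ∑ l, ∑ m, F i k l m a :=
  (Finset.sum_congr rfl fun i _ => (Finset.sum_congr rfl fun k _ =>
    sum_three_rotate (F i k)).trans Finset.sum_comm).trans Finset.sum_comm

/-- The relabelling `i ↔ k`, `l ↔ m` preserves the weight `h k m * h i l`. It expresses the pair
symmetry of the curvature tensor. -/
theorem sum_four_swap (F : ι → ι → ι → ι → ℝ) :
    ∑ i, ∑ k, ∑ l, ∑ m, F i k l m = ∑ i, ∑ k, ∑ l, ∑ m, F k i m l := by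
  rw [Finset.sum_comm]
  exact Finset.sum_congr rfl fun i _ => Finset.sum_congr rfl fun k _ => Finset.sum_comm

theorem sum_four_factor (P : ι → ι → ℝ) (D : ι → ι → ι → ι → ℝ) :
    ∑ i, ∑ k, ∑ l, ∑ m, P k m * D i k l m = ∑ k, ∑ m, P k m * ∑ i, ∑ l, D i k l m := by
  rw [Finset.sum_comm]
  refine Finset.sum_congr rfl fun k _ => ?_
  rw [sum_three_rotate]
  exact Finset.sum_congr rfl fun m _ => by simp only [Finset.mul_sum]

theorem sum_four_factor' (P : ι → ι → ℝ) (D : ι → ι → ι → ι → ℝ) :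
    ∑ i, ∑ k, ∑ l, ∑ m, P i l * D i k l m = ∑ i, ∑ l, P i l * ∑ k, ∑ m, D i k l m := by
  rw [sum_four_swap, sum_four_factor P fun i k l m => D k i m l]

theorem crossContraction_comm {g h : ι → ι → ℝ} (gs : ∀ i j, g i j = g j i)
    (A B : ι → ι → ι → ℝ) : crossContraction g h A B = crossContraction g h B A := by
  rw [crossContraction, sum_four_swap]
  refine Finset.sum_congr rfl fun i _ => Finset.sum_congr rfl fun k _ =>
    Finset.sum_congr rfl fun l _ => Finset.sum_congr rfl fun m _ => ?_
  rw [mul_comm (h i l)]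
  congr 1
  rw [Finset.sum_comm]
  refine Finset.sum_congr rfl fun a _ => Finset.sum_congr rfl fun b _ => ?_
  rw [gs b a]; ring

theorem crossContraction_add (g h : ι → ι → ℝ) (A B C : ι → ι → ι → ℝ) :
    crossContraction g h (fun a k l => A a k l + B a k l) C
      = crossContraction g h A C + crossContraction g h B C := by
  simp only [crossContraction, ← Finset.sum_add_distrib, ← mul_add, ← add_mul]

theorem crossContraction_eq (g h : ι → ι → ℝ) (A B : ι → ι → ι → ℝ) :
    crossContraction g h A B
      = ∑ i, ∑ m, ∑ b, (∑ k, ∑ l, h k m * h i l * ∑ a, g a b * A a k l) * B b i m := by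
  refine Finset.sum_congr rfl fun i _ => ?_
  rw [sum_three_rotate]
  refine Finset.sum_congr rfl fun m _ => ?_
  simp only [Finset.sum_mul, Finset.mul_sum]
  rw [← sum_three_rotate fun k l b => ∑ a, h k m * h i l * (g a b * A a k l) * B b i m]
  refine Finset.sum_congr rfl fun k _ => Finset.sum_congr rfl fun l _ => ?_
  rw [Finset.sum_comm]
  refine Finset.sum_congr rfl fun a _ => Finset.sum_congr rfl fun b _ => ?_
  ring

theorem sum_lowerTrace_mul (g h : ι → ι → ℝ) (A B : ι → ι → ι → ℝ) :
    ∑ i, ∑ k, ∑ l, ∑ m, h k m * h i l * ∑ a, ∑ b, g a b * (A a k m * B b i l)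
      = ∑ a, ∑ b, g a b * (lowerTrace h A a * lowerTrace h B b) := by
  simp only [Finset.mul_sum]
  rw [sum_five_rotate]
  refine Finset.sum_congr rfl fun a _ => ?_
  rw [sum_five_rotate]
  refine Finset.sum_congr rfl fun b _ => ?_
  have e : ∀ i k l m, h k m * h i l * (g a b * (A a k m * B b i l))
      = (g a b * (h k m * A a k m)) * (h i l * B b i l) := fun i k l m => by ring
  simp only [e]
  rw [sum_four_factor (fun k m => g a b * (h k m * A a k m)) fun i _ l _ => h i l * B b i l]
  simp only [← Finset.sum_mul, ← Finset.mul_sum, lowerTrace]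
  ring

/-- By the pair symmetry the four second-derivative terms coincide two by two, which absorbs the
factor `1/2`; the second quadratic term factors through the traces of the Christoffel symbols. -/
theorem scalarCurvAt_eq (g h : ι → ι → ℝ) (d : ι → ι → ι → ℝ) (dd : ι → ι → ι → ι → ℝ) :
    scalarCurvAt g h d dd = curvLinear h dd
      + crossContraction g h (christoffelAt h d) (christoffelAt h d)
      - ∑ a, ∑ b, g a b * (lowerTrace h (christoffelAt h d) a
          * lowerTrace h (christoffelAt h d) b) := by
  have e1 : ∑ i, ∑ k, ∑ l, ∑ m, h k m * h i l * (1 / 2 * (dd i m k l - dd i l k m))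
      = ∑ i, ∑ k, ∑ l, ∑ m, h k m * h i l * (1 / 2 * (dd k l i m - dd k m i l)) := by
    rw [sum_four_swap]
    refine Finset.sum_congr rfl fun i _ => Finset.sum_congr rfl fun k _ =>
      Finset.sum_congr rfl fun l _ => Finset.sum_congr rfl fun m _ => by ring
  have e2 : curvLinear h dd
      = (∑ i, ∑ k, ∑ l, ∑ m, h k m * h i l * (1 / 2 * (dd k l i m - dd k m i l)))
        + ∑ i, ∑ k, ∑ l, ∑ m, h k m * h i l * (1 / 2 * (dd i m k l - dd i l k m)) := by
    rw [e1]
    simp only [curvLinear, ← Finset.sum_add_distrib]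
    refine Finset.sum_congr rfl fun i _ => Finset.sum_congr rfl fun k _ =>
      Finset.sum_congr rfl fun l _ => Finset.sum_congr rfl fun m _ => by ring
  rw [e2, ← sum_lowerTrace_mul, crossContraction]
  simp only [scalarCurvAt, ← Finset.sum_add_distrib, ← Finset.sum_sub_distrib]
  refine Finset.sum_congr rfl fun i _ => Finset.sum_congr rfl fun k _ =>
    Finset.sum_congr rfl fun l _ => Finset.sum_congr rfl fun m _ => ?_
  simp only [mul_sub (g _ _), Finset.sum_sub_distrib]
  ring

/-! ### Contractions of the difference of conformal Christoffel symbols -/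

section Conformal

variable [DecidableEq ι] {g h : ι → ι → ℝ} (f : ι → ℝ)

/-- `fᵏ = g^{kl} f_l`. -/
def raiseVec (h : ι → ι → ℝ) (f : ι → ℝ) (k : ι) : ℝ := ∑ l, h k l * f l

/-- The difference `Cᵏᵢⱼ = δᵏⱼ fᵢ + δᵏᵢ fⱼ - gᵢⱼ fᵏ` of the Christoffel symbols of conformal
metrics. -/
def conformalDiff (g h : ι → ι → ℝ) (f : ι → ℝ) (k i j : ι) : ℝ :=
  (if k = j then f i else 0) + (if k = i then f j else 0) - g i j * raiseVec h f k

theorem sum_mul_raiseVec (hs : ∀ i j, h i j = h j i)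
    (hg : ∀ i j, ∑ l, h i l * g l j = if i = j then 1 else 0) (b : ι) :
    ∑ a, g a b * raiseVec h f a = f b := by
  simp only [raiseVec, Finset.mul_sum]
  rw [Finset.sum_comm]
  have e : ∀ l, ∑ a, g a b * (h a l * f l) = if l = b then f l else 0 := fun l => by
    have := hg l b
    calc _ = (∑ a, h l a * g a b) * f l := by
          rw [Finset.sum_mul]
          exact Finset.sum_congr rfl fun a _ => by rw [hs l a]; ring
      _ = _ := by rw [this]; split_ifs <;> simp
  simp [e]

theorem sum_mul_conformalDiff (hs : ∀ i j, h i j = h j i)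
    (hg : ∀ i j, ∑ l, h i l * g l j = if i = j then 1 else 0) (b k l : ι) :
    ∑ a, g a b * conformalDiff g h f a k l = g l b * f k + g k b * f l - g k l * f b := by
  have e : ∑ a, g a b * (g k l * raiseVec h f a) = g k l * f b := by
    rw [← sum_mul_raiseVec f hs hg b, Finset.mul_sum]
    exact Finset.sum_congr rfl fun a _ => by ring
  simp only [conformalDiff, mul_sub, mul_add, Finset.sum_sub_distrib, Finset.sum_add_distrib, e]
  simp

/-- Lowering the upper index of the difference tensor and raising the other two gives `δᵢᵇ fᵐ + δₘᵇ
fⁱ - g^{im} f_b`. Against a symmetric `B` the first two terms give equal mixed traces. -/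
theorem crossContraction_conformalDiff (gs : ∀ i j, g i j = g j i) (hs : ∀ i j, h i j = h j i)
    (hg : ∀ i j, ∑ l, h i l * g l j = if i = j then 1 else 0) (B : ι → ι → ι → ℝ)
    (hB : ∀ k i j, B k i j = B k j i) :
    crossContraction g h (conformalDiff g h f) B
      = 2 * (∑ m, raiseVec h f m * mixedTrace B m) - ∑ b, f b * lowerTrace h B b := by
  have hg' : ∀ i j, ∑ l, h l i * g j l = if i = j then 1 else 0 := fun i j => by
    rw [← hg i j]
    exact Finset.sum_congr rfl fun l _ => by rw [hs l i, gs j l]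
  have raise (i m b : ι) : ∑ k, ∑ l, h k m * h i l * (g l b * f k + g k b * f l - g k l * f b)
      = (if i = b then raiseVec h f m else 0) + (if m = b then raiseVec h f i else 0)
        - h i m * f b := by
    have t1 : ∑ k, ∑ l, h k m * h i l * (g l b * f k) = if i = b then raiseVec h f m else 0 := by
      calc _ = ∑ k, h m k * f k * ∑ l, h i l * g l b := by
            refine Finset.sum_congr rfl fun k _ => ?_
            rw [Finset.mul_sum]
            exact Finset.sum_congr rfl fun l _ => by rw [hs k m]; ring
        _ = _ := by rw [hg, ← Finset.sum_mul]; simp [raiseVec]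
    have t2 : ∑ k, ∑ l, h k m * h i l * (g k b * f l) = if m = b then raiseVec h f i else 0 := by
      rw [Finset.sum_comm]
      calc _ = ∑ l, h i l * f l * ∑ k, h m k * g k b := by
            refine Finset.sum_congr rfl fun l _ => ?_
            rw [Finset.mul_sum]
            exact Finset.sum_congr rfl fun k _ => by rw [hs k m]; ring
        _ = _ := by rw [hg, ← Finset.sum_mul]; simp [raiseVec]
    have t3 : ∑ k, ∑ l, h k m * h i l * (g k l * f b) = h i m * f b := by
      rw [Finset.sum_comm]
      calc _ = ∑ l, h i l * f b * ∑ k, h m k * g k l := by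
            refine Finset.sum_congr rfl fun l _ => ?_
            rw [Finset.mul_sum]
            exact Finset.sum_congr rfl fun k _ => by rw [hs k m]; ring
        _ = _ := by simp [hg]
    simp only [mul_sub, mul_add, Finset.sum_sub_distrib, Finset.sum_add_distrib, t1, t2, t3]
  rw [crossContraction_eq]
  simp only [sum_mul_conformalDiff f hs hg, raise, add_mul, sub_mul, Finset.sum_sub_distrib,
    Finset.sum_add_distrib]
  have s1 : ∑ i, ∑ m, ∑ b, (if i = b then raiseVec h f m else 0) * B b i m
      = ∑ m, raiseVec h f m * mixedTrace B m := by
    rw [Finset.sum_comm]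
    simp [mixedTrace, Finset.mul_sum]
  have s2 : ∑ i, ∑ m, ∑ b, (if m = b then raiseVec h f i else 0) * B b i m
      = ∑ m, raiseVec h f m * mixedTrace B m := by
    simp only [mixedTrace, Finset.mul_sum]
    simp [hB _ _]
  have s3 : ∑ i, ∑ m, ∑ b, h i m * f b * B b i m = ∑ b, f b * lowerTrace h B b := by
    rw [sum_three_rotate]
    simp only [lowerTrace, Finset.mul_sum]
    exact Finset.sum_congr rfl fun b _ => Finset.sum_congr rfl fun k _ =>
      Finset.sum_congr rfl fun m _ => by ring
  rw [s1, s2, s3]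
  ring

theorem conformalDiff_symm (gs : ∀ i j, g i j = g j i) (k i j : ι) :
    conformalDiff g h f k i j = conformalDiff g h f k j i := by
  rw [conformalDiff, conformalDiff, gs i j]
  ring

theorem lowerTrace_conformalDiff (gs : ∀ i j, g i j = g j i) (hs : ∀ i j, h i j = h j i)
    (hg : ∀ i j, ∑ l, h i l * g l j = if i = j then 1 else 0) (a : ι) :
    lowerTrace h (conformalDiff g h f) a = (2 - Fintype.card ι) * raiseVec h f a := by
  have t3 : ∑ k, ∑ m, h k m * (g k m * raiseVec h f a) = Fintype.card ι * raiseVec h f a := by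
    calc _ = ∑ k, (∑ m, h k m * g m k) * raiseVec h f a := by
          refine Finset.sum_congr rfl fun k _ => ?_
          rw [Finset.sum_mul]
          exact Finset.sum_congr rfl fun m _ => by rw [gs k m]; ring
      _ = _ := by simp [hg]
  simp only [lowerTrace, conformalDiff, mul_sub, mul_add, Finset.sum_sub_distrib,
    Finset.sum_add_distrib, t3]
  simp [raiseVec, hs _ a]
  ring

theorem mixedTrace_conformalDiff (gs : ∀ i j, g i j = g j i) (hs : ∀ i j, h i j = h j i)
    (hg : ∀ i j, ∑ l, h i l * g l j = if i = j then 1 else 0) (m : ι) :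
    mixedTrace (conformalDiff g h f) m = Fintype.card ι * f m := by
  simp only [mixedTrace, conformalDiff, Finset.sum_sub_distrib, Finset.sum_add_distrib,
    fun i => gs i m]
  have := sum_mul_raiseVec f hs hg m
  simp_rw [gs _ m] at this
  simp [this]

end Conformal

end PointwiseAlgebra
-- Scalar curvature of a conformal metric `u g`
section ConformalCurvature

variable {ι : Type*} [Fintype ι] {g h : ι → ι → ℝ} {d : ι → ι → ι → ℝ}

theorem christoffelAt_symm (ds : ∀ k i j, d k i j = d k j i) (k i j : ι) :
    christoffelAt h d k i j = christoffelAt h d k j i := by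
  simp only [christoffelAt, ds _ i j, add_comm (d i j _)]

/-- The contraction `g^{il} ∂ₗ g_{ij}`. -/
def divMetric (h : ι → ι → ℝ) (d : ι → ι → ι → ℝ) (j : ι) : ℝ := ∑ i, ∑ l, h i l * d l i j

/-- The contraction `g^{il} ∂ₖ g_{il}`. -/
def traceMetric (h : ι → ι → ℝ) (d : ι → ι → ι → ℝ) (k : ι) : ℝ := ∑ i, ∑ l, h i l * d k i l

theorem mixedTrace_christoffelAt (hs : ∀ i j, h i j = h j i) (ds : ∀ k i j, d k i j = d k j i)
    (m : ι) : mixedTrace (christoffelAt h d) m = 1 / 2 * traceMetric h d m := by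
  have e : ∑ i, ∑ l, h i l * d i m l = ∑ i, ∑ l, h i l * d l i m := by
    rw [Finset.sum_comm]
    exact Finset.sum_congr rfl fun i _ => Finset.sum_congr rfl fun l _ => by rw [hs l i, ds]
  simp only [mixedTrace, christoffelAt, traceMetric, ← Finset.mul_sum, mul_sub, mul_add,
    Finset.sum_sub_distrib, Finset.sum_add_distrib, e]
  ring

/-- This expresses `f · Γ` through the same two contractions as `curvLinear_conformal`, so that
first-order terms can be collected. -/
theorem sum_mul_lowerTrace_christoffelAt (hs : ∀ i j, h i j = h j i) (f : ι → ℝ) :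
    ∑ b, f b * lowerTrace h (christoffelAt h d) b
      = ∑ m, raiseVec h f m * (divMetric h d m - 1 / 2 * traceMetric h d m) := by
  have e1 (l : ι) : ∑ i, ∑ j, h i j * d i j l = divMetric h d l := by
    rw [Finset.sum_comm]
    exact Finset.sum_congr rfl fun i _ => Finset.sum_congr rfl fun j _ => by rw [hs]
  have e2 (l : ι) : ∑ i, ∑ j, h i j * d j i l = divMetric h d l := rfl
  have e3 (l : ι) : ∑ i, ∑ j, h i j * d l i j = traceMetric h d l := rfl
  have e (b : ι) : lowerTrace h (christoffelAt h d) b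
      = ∑ l, h b l * (divMetric h d l - 1 / 2 * traceMetric h d l) := by
    simp only [lowerTrace, christoffelAt, Finset.mul_sum]
    rw [sum_three_rotate]
    refine Finset.sum_congr rfl fun l _ => ?_
    rw [show divMetric h d l - 1 / 2 * traceMetric h d l
      = 1 / 2 * (divMetric h d l + divMetric h d l - traceMetric h d l) by ring]
    nth_rw 1 [← e1]
    rw [← e2, ← e3]
    simp only [← Finset.sum_sub_distrib, ← Finset.sum_add_distrib, Finset.mul_sum]
    exact Finset.sum_congr rfl fun i _ => Finset.sum_congr rfl fun j _ => by ring
  simp only [e, raiseVec, Finset.mul_sum, Finset.sum_mul]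
  rw [Finset.sum_comm]
  exact Finset.sum_congr rfl fun l _ => Finset.sum_congr rfl fun b _ => by rw [hs l b]; ring

theorem curvLinear_smul_add (c u : ℝ) (dd E : ι → ι → ι → ι → ℝ) :
    curvLinear (fun i j => c * h i j) (fun k l i j => u * dd k l i j + E k l i j)
      = c ^ 2 * (u * curvLinear h dd + curvLinear h E) := by
  simp only [curvLinear, Finset.mul_sum, ← Finset.sum_add_distrib]
  refine Finset.sum_congr rfl fun i _ => Finset.sum_congr rfl fun k _ =>
    Finset.sum_congr rfl fun l _ => Finset.sum_congr rfl fun m _ => by ring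

theorem crossContraction_smul {u : ℝ} (hu : u ≠ 0) (A B : ι → ι → ι → ℝ) :
    crossContraction (fun i j => u * g i j) (fun i j => u⁻¹ * h i j) A B
      = u⁻¹ * crossContraction g h A B := by
  simp only [crossContraction, Finset.mul_sum]
  refine Finset.sum_congr rfl fun i _ => Finset.sum_congr rfl fun k _ =>
    Finset.sum_congr rfl fun l _ => Finset.sum_congr rfl fun m _ =>
    Finset.sum_congr rfl fun a _ => Finset.sum_congr rfl fun b _ => by field_simp

theorem lowerTrace_smul (c : ℝ) (A : ι → ι → ι → ℝ) (a : ι) :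
    lowerTrace (fun i j => c * h i j) A a = c * lowerTrace h A a := by
  simp only [lowerTrace, Finset.mul_sum]
  exact Finset.sum_congr rfl fun i _ => Finset.sum_congr rfl fun k _ => by ring

theorem lowerTrace_add (A B : ι → ι → ι → ℝ) (a : ι) :
    lowerTrace h (fun k i j => A k i j + B k i j) a = lowerTrace h A a + lowerTrace h B a := by
  simp only [lowerTrace, ← Finset.sum_add_distrib, ← mul_add]

variable [DecidableEq ι]

theorem christoffelAt_conformal (hg : ∀ i j, ∑ l, h i l * g l j = if i = j then 1 else 0)
    (gs : ∀ i j, g i j = g j i) {u : ℝ} (hu : u ≠ 0) (f : ι → ℝ) (k i j : ι) :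
    christoffelAt (fun i j => u⁻¹ * h i j) (fun k i j => u * d k i j + 2 * u * f k * g i j) k i j
      = christoffelAt h d k i j + conformalDiff g h f k i j := by
  have e1 : ∑ l, h k l * (f i * g j l) = if k = j then f i else 0 := by
    calc _ = (∑ l, h k l * g l j) * f i := by
          rw [Finset.sum_mul]
          exact Finset.sum_congr rfl fun l _ => by rw [gs j l]; ring
      _ = _ := by rw [hg]; split_ifs <;> simp
  have e2 : ∑ l, h k l * (f j * g i l) = if k = i then f j else 0 := by
    calc _ = (∑ l, h k l * g l i) * f j := by
          rw [Finset.sum_mul]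
          exact Finset.sum_congr rfl fun l _ => by rw [gs i l]; ring
      _ = _ := by rw [hg]; split_ifs <;> simp
  rw [conformalDiff, ← e1, ← e2, raiseVec, christoffelAt, christoffelAt]
  simp only [Finset.mul_sum, ← Finset.sum_sub_distrib, ← Finset.sum_add_distrib]
  refine Finset.sum_congr rfl fun l _ => ?_
  field_simp
  ring

/-- Contracting `g_{im}` leaves one copy of the trace of `w`, while `g_{il}` gives the dimension;
hence the factor `1 - n`. -/
theorem curvLinear_conformal (gs : ∀ i j, g i j = g j i) (hs : ∀ i j, h i j = h j i)
    (hg : ∀ i j, ∑ l, h i l * g l j = if i = j then 1 else 0)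
    (ds : ∀ k i j, d k i j = d k j i) (v : ι → ℝ) (w : ι → ι → ℝ) :
    curvLinear h (fun k l i j => v k * d l i j + v l * d k i j + w k l * g i j)
      = 2 * (∑ m, raiseVec h v m * (divMetric h d m - traceMetric h d m))
        + (1 - Fintype.card ι) * ∑ k, ∑ l, h k l * w k l := by
  have rv (m : ι) : ∑ k, h k m * v k = raiseVec h v m :=
    Finset.sum_congr rfl fun k _ => by rw [hs k m]
  have t1 : ∑ i, ∑ k, ∑ l, ∑ m, h k m * h i l * (v k * d l i m)
      = ∑ m, raiseVec h v m * divMetric h d m := by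
    have := sum_four_factor (fun k m => h k m * v k) fun i _ l m => h i l * d l i m
    refine Eq.trans (Finset.sum_congr rfl fun i _ => Finset.sum_congr rfl fun k _ =>
      Finset.sum_congr rfl fun l _ => Finset.sum_congr rfl fun m _ => by ring) (this.trans ?_)
    rw [Finset.sum_comm]
    exact Finset.sum_congr rfl fun m _ => by rw [← rv, Finset.sum_mul]; rfl
  have t2 : ∑ i, ∑ k, ∑ l, ∑ m, h k m * h i l * (v l * d k i m)
      = ∑ m, raiseVec h v m * divMetric h d m := by
    have := sum_four_factor' (fun i l => h i l * v l) fun i k _ m => h k m * d k i m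
    refine Eq.trans (Finset.sum_congr rfl fun i _ => Finset.sum_congr rfl fun k _ =>
      Finset.sum_congr rfl fun l _ => Finset.sum_congr rfl fun m _ => by ring) (this.trans ?_)
    refine Finset.sum_congr rfl fun i _ => ?_
    rw [← Finset.sum_mul, raiseVec, divMetric]
    congr 1
    rw [Finset.sum_comm]
    exact Finset.sum_congr rfl fun m _ => Finset.sum_congr rfl fun k _ => by rw [hs k m, ds]
  have t3 : ∑ i, ∑ k, ∑ l, ∑ m, h k m * h i l * (w k l * g i m) = ∑ k, ∑ l, h k l * w k l := by
    rw [Finset.sum_comm]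
    refine Finset.sum_congr rfl fun k _ => ?_
    rw [Finset.sum_comm]
    refine Finset.sum_congr rfl fun l _ => ?_
    calc _ = ∑ i, h i l * w k l * ∑ m, h k m * g m i := by
          refine Finset.sum_congr rfl fun i _ => ?_
          rw [Finset.mul_sum]
          exact Finset.sum_congr rfl fun m _ => by rw [gs i m]; ring
      _ = _ := by simp [hg]
  have t4 : ∑ i, ∑ k, ∑ l, ∑ m, h k m * h i l * (v k * d m i l)
      = ∑ m, raiseVec h v m * traceMetric h d m := by
    have := sum_four_factor (fun k m => h k m * v k) fun i _ l m => h i l * d m i l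
    refine Eq.trans (Finset.sum_congr rfl fun i _ => Finset.sum_congr rfl fun k _ =>
      Finset.sum_congr rfl fun l _ => Finset.sum_congr rfl fun m _ => by ring) (this.trans ?_)
    rw [Finset.sum_comm]
    exact Finset.sum_congr rfl fun m _ => by rw [← rv, Finset.sum_mul]; rfl
  have t5 : ∑ i, ∑ k, ∑ l, ∑ m, h k m * h i l * (v m * d k i l)
      = ∑ m, raiseVec h v m * traceMetric h d m := by
    have := sum_four_factor (fun k m => h k m * v m) fun i k l _ => h i l * d k i l
    refine Eq.trans (Finset.sum_congr rfl fun i _ => Finset.sum_congr rfl fun k _ =>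
      Finset.sum_congr rfl fun l _ => Finset.sum_congr rfl fun m _ => by ring) (this.trans ?_)
    exact Finset.sum_congr rfl fun m _ => by rw [raiseVec, Finset.sum_mul]; rfl
  have t6 : ∑ i, ∑ k, ∑ l, ∑ m, h k m * h i l * (w k m * g i l)
      = Fintype.card ι * ∑ k, ∑ l, h k l * w k l := by
    have := sum_four_factor (fun k m => h k m * w k m) fun i _ l _ => h i l * g l i
    refine Eq.trans (Finset.sum_congr rfl fun i _ => Finset.sum_congr rfl fun k _ =>
      Finset.sum_congr rfl fun l _ => Finset.sum_congr rfl fun m _ => by rw [gs i l]; ring)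
      (this.trans ?_)
    have tr : ∑ i, ∑ l, h i l * g l i = Fintype.card ι := by simp [hg]
    simp only [tr, ← Finset.sum_mul]
    ring
  simp only [curvLinear, mul_sub, mul_add, Finset.sum_sub_distrib, Finset.sum_add_distrib,
    t1, t2, t3, t4, t5, t6]
  ring

/-- The scalar curvature of the conformal metric `u g`, where `2 u fₖ` and `w k l` stand for the
first and second derivatives of `u`. -/
theorem scalarCurvAt_conformal (gs : ∀ i j, g i j = g j i) (hs : ∀ i j, h i j = h j i)
    (hg : ∀ i j, ∑ l, h i l * g l j = if i = j then 1 else 0)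
    (ds : ∀ k i j, d k i j = d k j i) (dd : ι → ι → ι → ι → ℝ) {u : ℝ} (hu : u ≠ 0)
    (f : ι → ℝ) (w : ι → ι → ℝ) :
    scalarCurvAt (fun i j => u * g i j) (fun i j => u⁻¹ * h i j)
        (fun k i j => u * d k i j + 2 * u * f k * g i j)
        (fun k l i j => u * dd k l i j
          + (2 * u * f k * d l i j + 2 * u * f l * d k i j + w k l * g i j))
      = u⁻¹ * (scalarCurvAt g h d dd + (1 - Fintype.card ι) * u⁻¹ * (∑ k, ∑ l, h k l * w k l)
        + 2 * (Fintype.card ι - 1) * (∑ b, f b * lowerTrace h (christoffelAt h d) b)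
        - (Fintype.card ι - 1) * (Fintype.card ι - 6) * ∑ b, f b * raiseVec h f b) := by
  have hΓ : christoffelAt (fun i j => u⁻¹ * h i j)
      (fun k i j => u * d k i j + 2 * u * f k * g i j)
      = fun k i j => christoffelAt h d k i j + conformalDiff g h f k i j := by
    funext k i j
    exact christoffelAt_conformal hg gs hu f k i j
  have hCs := conformalDiff_symm (h := h) f gs
  have hΓs := christoffelAt_symm (h := h) ds
  have x1 : crossContraction g h (conformalDiff g h f) (christoffelAt h d)
      = 2 * (∑ m, raiseVec h f m * mixedTrace (christoffelAt h d) m)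
        - ∑ b, f b * lowerTrace h (christoffelAt h d) b :=
    crossContraction_conformalDiff f gs hs hg _ hΓs
  have x2 : crossContraction g h (conformalDiff g h f) (conformalDiff g h f)
      = (3 * Fintype.card ι - 2) * ∑ b, f b * raiseVec h f b := by
    rw [crossContraction_conformalDiff f gs hs hg _ hCs]
    simp only [mixedTrace_conformalDiff f gs hs hg, lowerTrace_conformalDiff f gs hs hg,
      Finset.mul_sum, ← Finset.sum_sub_distrib]
    exact Finset.sum_congr rfl fun b _ => by ring
  have x3 : crossContraction g h
        (fun k i j => christoffelAt h d k i j + conformalDiff g h f k i j)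
        (fun k i j => christoffelAt h d k i j + conformalDiff g h f k i j)
      = crossContraction g h (christoffelAt h d) (christoffelAt h d)
        + 2 * crossContraction g h (conformalDiff g h f) (christoffelAt h d)
        + crossContraction g h (conformalDiff g h f) (conformalDiff g h f) := by
    rw [crossContraction_add, crossContraction_comm gs (christoffelAt h d),
      crossContraction_comm gs (conformalDiff g h f), crossContraction_add, crossContraction_add,
      crossContraction_comm gs (christoffelAt h d) (conformalDiff g h f)]
    ring
  have y1 : ∑ a, ∑ b, u * g a b * (u⁻¹ * (lowerTrace h (christoffelAt h d) a
          + (2 - Fintype.card ι) * raiseVec h f a)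
        * (u⁻¹ * (lowerTrace h (christoffelAt h d) b + (2 - Fintype.card ι) * raiseVec h f b)))
      = u⁻¹ * ((∑ a, ∑ b, g a b * (lowerTrace h (christoffelAt h d) a
            * lowerTrace h (christoffelAt h d) b))
          + 2 * (2 - Fintype.card ι) * (∑ b, f b * lowerTrace h (christoffelAt h d) b)
          + (2 - Fintype.card ι) ^ 2 * ∑ b, f b * raiseVec h f b) := by
    have e1 (V : ι → ℝ) : ∑ b, f b * V b = ∑ a, ∑ b, g a b * (raiseVec h f a * V b) := by
      rw [Finset.sum_comm]
      refine Finset.sum_congr rfl fun b _ => ?_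
      rw [← sum_mul_raiseVec f hs hg b, Finset.sum_mul]
      exact Finset.sum_congr rfl fun a _ => by ring
    have e2 (V : ι → ℝ) : ∑ b, f b * V b = ∑ a, ∑ b, g a b * (V a * raiseVec h f b) := by
      rw [e1, Finset.sum_comm]
      exact Finset.sum_congr rfl fun b _ => Finset.sum_congr rfl fun a _ => by rw [gs]; ring
    rw [mul_assoc, two_mul]
    nth_rw 1 [e1]
    rw [e2 (lowerTrace h _), e1]
    simp only [Finset.mul_sum, ← Finset.sum_add_distrib]
    refine Finset.sum_congr rfl fun a _ => Finset.sum_congr rfl fun b _ => ?_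
    field_simp
    ring
  have z1 : ∀ m, raiseVec h (fun k => 2 * u * f k) m = 2 * u * raiseVec h f m := fun m => by
    simp only [raiseVec, Finset.mul_sum]
    exact Finset.sum_congr rfl fun l _ => by ring
  rw [scalarCurvAt_eq, scalarCurvAt_eq, hΓ, curvLinear_smul_add,
    curvLinear_conformal gs hs hg ds (fun k => 2 * u * f k) w, crossContraction_smul hu, x3, x1, x2]
  have hL (a : ι) : lowerTrace (fun i j => u⁻¹ * h i j)
      (fun k i j => christoffelAt h d k i j + conformalDiff g h f k i j) a
      = u⁻¹ * (lowerTrace h (christoffelAt h d) a + (2 - Fintype.card ι) * raiseVec h f a) := by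
    rw [lowerTrace_smul, lowerTrace_add, lowerTrace_conformalDiff f gs hs hg]
  simp only [hL]
  -- First-order terms, with `div` and `tr` contracted against `fᵐ`: `4 (div - tr)` from the second
  -- derivatives and `2 tr` from the mixed trace make `4 f·Γ`; with `-2` and `2 (n-2)` the
  -- coefficient is `2 (n-1)`. The coefficient of `|f|²` is `(3n-2) - (n-2)² = -(n-1)(n-6)`.
  rw [y1, sum_mul_lowerTrace_christoffelAt hs]
  simp only [z1]
  simp only [mixedTrace_christoffelAt hs ds, mul_sub, Finset.sum_sub_distrib, mul_assoc,
    mul_left_comm (raiseVec h f _), ← Finset.mul_sum]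
  field_simp
  ring

end ConformalCurvature

/-! ### The conformal factor as a power, and the Laplacian -/

section ConformalPower

variable {ι : Type*} [Fintype ι] {g h : ι → ι → ℝ} {d : ι → ι → ι → ℝ}

/-- The Laplacian from first and second derivatives `p` and `pp`. -/
noncomputable def laplaceAt (h : ι → ι → ℝ) (d : ι → ι → ι → ℝ) (p : ι → ℝ) (pp : ι → ι → ℝ) : ℝ :=
  ∑ i, ∑ j, h i j * (pp i j - ∑ k, christoffelAt h d k i j * p k)

theorem laplaceAt_eq (p : ι → ℝ) (pp : ι → ι → ℝ) :
    laplaceAt h d p pp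
      = (∑ i, ∑ j, h i j * pp i j) - ∑ k, p k * lowerTrace h (christoffelAt h d) k := by
  simp only [laplaceAt, lowerTrace, mul_sub, Finset.sum_sub_distrib, Finset.mul_sum]
  congr 1
  rw [sum_three_rotate]
  exact Finset.sum_congr rfl fun k _ => Finset.sum_congr rfl fun i _ =>
    Finset.sum_congr rfl fun j _ => by ring

theorem laplaceAt_mul (c : ℝ) (p : ι → ℝ) (pp : ι → ι → ℝ) :
    laplaceAt h d (fun k => c * p k) (fun k l => c * pp k l) = c * laplaceAt h d p pp := by
  simp only [laplaceAt, Finset.mul_sum, mul_sub]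
  refine Finset.sum_congr rfl fun i _ => Finset.sum_congr rfl fun j _ => ?_
  rw [mul_left_comm]
  congr 1
  exact Finset.sum_congr rfl fun k _ => by ring

variable [DecidableEq ι]

/-- The scalar curvature of `φ ^ (4 / (n - 2)) g`. -/
theorem scalarCurvAt_rpow_conformal (gs : ∀ i j, g i j = g j i)
    (hs : ∀ i j, h i j = h j i) (hg : ∀ i j, ∑ l, h i l * g l j = if i = j then 1 else 0)
    (ds : ∀ k i j, d k i j = d k j i) (dd : ι → ι → ι → ι → ℝ) {φ : ℝ} (hφ : 0 < φ)
    (p : ι → ℝ) (pp : ι → ι → ℝ) {s : ℝ} (hs4 : s * (Fintype.card ι - 2) = 4) :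
    scalarCurvAt (fun i j => φ ^ s * g i j) (fun i j => (φ ^ s)⁻¹ * h i j)
        (fun k i j => φ ^ s * d k i j + s * φ ^ (s - 1) * p k * g i j)
        (fun k l i j => φ ^ s * dd k l i j
          + s * φ ^ (s - 1) * (p k * d l i j + p l * d k i j + pp k l * g i j)
          + s * (s - 1) * φ ^ (s - 1 - 1) * p k * p l * g i j)
      = (φ ^ s)⁻¹ * (scalarCurvAt g h d dd
          - (Fintype.card ι - 1) * s * φ⁻¹ * laplaceAt h d p pp) := by
  have hu : φ ^ s ≠ 0 := (Real.rpow_pos_of_pos hφ s).ne'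
  -- For `u = φ^s` the relation `∂ₖu = 2 u fₖ` forces `fₖ = s pₖ / (2φ)`; the last argument is the
  -- Hessian of `φ^s`.
  have key := scalarCurvAt_conformal gs hs hg ds dd hu (fun k => s * p k / (2 * φ))
    (fun k l => φ ^ s * (s * pp k l / φ + s * (s - 1) * (p k * p l) / φ ^ 2))
  have e1 : (∑ k, ∑ l, h k l * (φ ^ s * (s * pp k l / φ + s * (s - 1) * (p k * p l) / φ ^ 2)))
      = φ ^ s * (s / φ * (∑ k, ∑ l, h k l * pp k l)
        + s * (s - 1) / φ ^ 2 * ∑ b, p b * raiseVec h p b) := by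
    simp only [raiseVec, Finset.mul_sum, ← Finset.sum_add_distrib]
    exact Finset.sum_congr rfl fun k _ => Finset.sum_congr rfl fun l _ => by ring
  have e2 : ∑ b, s * p b / (2 * φ) * lowerTrace h (christoffelAt h d) b
      = s / (2 * φ) * ∑ b, p b * lowerTrace h (christoffelAt h d) b := by
    rw [Finset.mul_sum]
    exact Finset.sum_congr rfl fun b _ => by ring
  have e3 : ∑ b, s * p b / (2 * φ) * raiseVec h (fun k => s * p k / (2 * φ)) b
      = s ^ 2 / (4 * φ ^ 2) * ∑ b, p b * raiseVec h p b := by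
    simp only [raiseVec, Finset.mul_sum]
    exact Finset.sum_congr rfl fun k _ => Finset.sum_congr rfl fun l _ => by ring
  rw [e1, e2, e3] at key
  have e4 : φ ^ (s - 1) = φ ^ s / φ := Real.rpow_sub_one hφ.ne' s
  have e5 : φ ^ (s - 1 - 1) = φ ^ s / φ ^ 2 := by
    rw [Real.rpow_sub_one hφ.ne', e4, div_div, sq]
  refine Eq.trans ?_ (key.trans ?_)
  · congr 1
    · funext k i j
      rw [e4]
      field_simp
    · funext k l i j
      rw [e4, e5]
      field_simp
      ring
  · rw [laplaceAt_eq]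
    set q := ∑ b, p b * raiseVec h p b
    set P := ∑ k, ∑ l, h k l * pp k l
    set V := ∑ b, p b * lowerTrace h (christoffelAt h d) b
    set c : ℝ := (Fintype.card ι : ℝ)
    congr 1
    -- The gradient-squared terms carry the factor `s (n-2) - 4`; this is why the exponent is
    -- `4/(n-2)`.
    have hz : (1 - c) * (s * (s - 1) / φ ^ 2 * q) - (c - 1) * (c - 6) * (s ^ 2 / (4 * φ ^ 2) * q)
        = 0 := by
      have : (1 - c) * (s * (s - 1) / φ ^ 2 * q) - (c - 1) * (c - 6) * (s ^ 2 / (4 * φ ^ 2) * q)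
        = -(c - 1) * s / (4 * φ ^ 2) * q * (s * (c - 2) - 4) := by
        field_simp
        ring
      rw [this, hs4]
      ring
    have hinv : (1 - c) * (φ ^ s)⁻¹ * (φ ^ s * (s / φ * P + s * (s - 1) / φ ^ 2 * q))
        = (1 - c) * (s / φ * P) + (1 - c) * (s * (s - 1) / φ ^ 2 * q) := by
      field_simp
    rw [hinv]
    have h2 : 2 * (c - 1) * (s / (2 * φ) * V) = (c - 1) * s * φ⁻¹ * V := by
      field_simp
    rw [h2]
    linear_combination hz

end ConformalPower

/-! ### Metrics in charts -/

section Chart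

variable {n : ℕ}

theorem invMetric_mul {G : Fin n → Fin n → Euc n → ℝ} {x : Euc n}
    (hG : (Matrix.of fun a b => G a b x).PosDef) (i j : Fin n) :
    ∑ l, invMetric G i l x * G l j x = if i = j then 1 else 0 := by
  have := congr_fun₂ (Matrix.nonsing_inv_mul _ ((Matrix.isUnit_iff_isUnit_det _).1 hG.isUnit)) i j
  simpa [Matrix.mul_apply, Matrix.one_apply, invMetric] using this

theorem invMetric_symm {G : Fin n → Fin n → Euc n → ℝ} {x : Euc n}
    (hG : (Matrix.of fun a b => G a b x).PosDef) (i j : Fin n) :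
    invMetric G i j x = invMetric G j i x :=
  hG.inv.isHermitian.apply j i

theorem invMetric_smul {G : Fin n → Fin n → Euc n → ℝ} {x : Euc n} (hG : (Matrix.of fun a b => G a b x).PosDef) {u : Euc n → ℝ}
    (hu : u x ≠ 0) (i j : Fin n) :
    invMetric (fun a b y => u y * G a b y) i j x = (u x)⁻¹ * invMetric G i j x := by
  have h1 : (Matrix.of fun a b => u x * G a b x)
      = (Units.mk0 (u x) hu) • (Matrix.of fun a b => G a b x) := by
    ext a b
    simp [Units.smul_def]
  rw [invMetric, h1, Matrix.inv_smul' _ _ ((Matrix.isUnit_iff_isUnit_det _).1 hG.isUnit)]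
  simp [Units.smul_def, invMetric]

/-- The form on 2-tensors is the Kronecker square of the positive definite matrix `g⁻¹`. No symmetry
of `T` enters. -/
theorem normSq_nonneg {G : Fin n → Fin n → Euc n → ℝ} {x : Euc n}
    (hG : (Matrix.of fun a b => G a b x).PosDef) (T : Fin n → Fin n → Euc n → ℝ) :
    0 ≤ normSq G T x := by
  have h1 := hG.inv.posSemidef.kronecker hG.inv.posSemidef
  have h2 := h1.dotProduct_mulVec_nonneg fun q : Fin n × Fin n => T q.1 q.2 x
  refine h2.trans_eq ?_
  simp only [dotProduct, Matrix.mulVec, Fintype.sum_prod_type, normSq, Finset.mul_sum]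
  refine Finset.sum_congr rfl fun i _ => Finset.sum_congr rfl fun j _ =>
    Finset.sum_congr rfl fun k _ => Finset.sum_congr rfl fun l _ => ?_
  simp [Matrix.kroneckerMap_apply, invMetric]
  ring

variable {M : Type*} [TopologicalSpace M] [ChartedSpace (Euc n) M]
  [IsManifold 𝓘(ℝ, Euc n) ∞ M]

theorem tcomp_tensor_symm (g : Metric n M) (e : OpenPartialHomeomorph M (Euc n)) (i j : Fin n) :
    tcomp g.tensor e i j = tcomp g.tensor e j i :=
  funext fun _ => g.symm _ _ _

/-- The derivative of the inverse chart is injective, so a nontrivial combination of coordinate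
vectors is a nonzero tangent vector, on which `g` is positive. -/
theorem posDef_tcomp_tensor (g : Metric n M) {e : OpenPartialHomeomorph M (Euc n)}
    (he : e ∈ Charts n M) {x : Euc n} (hx : x ∈ e.target) :
    (Matrix.of fun a b => tcomp g.tensor e a b x).PosDef := by
  have : IsManifold 𝓘(ℝ, Euc n) 1 M := IsManifold.of_le (n := ∞) (by simp)
  have hd : e.MDifferentiable 𝓘(ℝ, Euc n) 𝓘(ℝ, Euc n) :=
    ⟨(contMDiffOn_of_mem_maximalAtlas he).mdifferentiableOn (by simp),
      (contMDiffOn_symm_of_mem_maximalAtlas he).mdifferentiableOn (by simp)⟩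
  have hinj := hd.symm.mfderiv_injective hx
  refine Matrix.PosDef.of_dotProduct_mulVec_pos ?_ fun v hv => ?_
  · ext a b
    simp [tcomp_tensor_symm g e a b]
  · have e1 : star v ⬝ᵥ Matrix.mulVec (Matrix.of fun a b => tcomp g.tensor e a b x) v
        = g.inner (e.symm x) (∑ a, v a • coordVec e a x) (∑ a, v a • coordVec e a x) := by
      rw [map_sum]
      simp only [dotProduct, Matrix.mulVec]
      refine Finset.sum_congr rfl fun a _ => ?_
      rw [map_smul, g.symm, map_sum, Pi.star_apply, star_trivial, smul_eq_mul]
      congr 1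
      refine Finset.sum_congr rfl fun b _ => ?_
      rw [map_smul, smul_eq_mul, mul_comm]
      rfl
    rw [e1]
    refine g.pos _ _ fun h0 => hv ?_
    have h1 : mfderiv 𝓘(ℝ, Euc n) 𝓘(ℝ, Euc n) e.symm x
        (∑ a, v a • (EuclideanSpace.single a (1 : ℝ) : Euc n)) = 0 := by
      rw [← h0]
      refine (map_sum _ _ _).trans (Finset.sum_congr rfl fun a _ => ?_)
      exact map_smul _ _ _
    have h2 : (∑ a, v a • (EuclideanSpace.single a (1 : ℝ) : Euc n)) = 0 :=
      hinj (h1.trans (map_zero _).symm)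
    funext a
    have h3 := congr_arg (fun w : Euc n => w a) h2
    simpa [Pi.single_apply] using h3

end Chart

/-! ### The conformal change of the scalar curvature -/

section Yamabe

variable {n : ℕ} {Ω : Set (Euc n)} {G : Fin n → Fin n → Euc n → ℝ} {F f : Euc n → ℝ} {p : ℝ≥0∞}

theorem scalarCurv_eq_scalarCurvAt (x : Euc n) :
    scalarCurv Ω G x = scalarCurvAt (fun i j => G i j x) (fun i j => invMetric G i j x)
      (fun k i j => weakPartial Ω k (G i j) x)
      (fun k l i j => weakPartial Ω k (weakPartial Ω l (G i j)) x) :=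
  rfl

theorem laplace_eq_laplaceAt (x : Euc n) :
    laplace Ω G F x = laplaceAt (fun i j => invMetric G i j x)
      (fun k i j => weakPartial Ω k (G i j) x) (fun k => weakPartial Ω k F x)
      (fun k l => weakPartial Ω k (weakPartial Ω l F) x) :=
  rfl

theorem laplace_affine_ae (hΩ : IsOpen Ω) (hf : MemWLoc 2 p Ω f) (a : ℝ) :
    ∀ᵐ x ∂volume.restrict Ω,
      laplace Ω G (fun y => a * (1 + f y)) x = a * laplace Ω G f x := by
  have h1 := ae_all_iff.2 fun i => hf.weakPartial_affine hΩ a i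
  have h2 := ae_all_iff.2 fun i => ae_all_iff.2 fun j =>
    hf.weakPartial_weakPartial_affine hΩ a i j
  filter_upwards [h1, h2] with x h1 h2
  simp only [laplace_eq_laplaceAt, h1, h2, laplaceAt_mul]

theorem scalarCurv_rpow_mul_ae (hΩ : IsOpen Ω) (hp : 3 ≤ p)
    (hG : ∀ i j, MemWLoc 2 p Ω (G i j)) (gs : ∀ i j, G i j = G j i)
    (hpd : ∀ x ∈ Ω, (Matrix.of fun a b => G a b x).PosDef) (hFc : ContinuousOn F Ω)
    (hpos : ∀ x ∈ Ω, 0 < F x) (hF : MemWLoc 2 p Ω F) {s : ℝ} (hs : s * ((n : ℝ) - 2) = 4) :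
    ∀ᵐ x ∂volume.restrict Ω, scalarCurv Ω (fun i j y => F y ^ s * G i j y) x
      = (F x ^ s)⁻¹ * (scalarCurv Ω G x
        - ((n : ℝ) - 1) * s * (F x)⁻¹ * laplace Ω G F x) := by
  have h1 := ae_all_iff.2 fun k => ae_all_iff.2 fun i => ae_all_iff.2 fun j =>
    hF.weakPartial_rpow_mul hΩ hp hFc hpos (hG i j) s k
  have h2 := ae_all_iff.2 fun k => ae_all_iff.2 fun l => ae_all_iff.2 fun i =>
    ae_all_iff.2 fun j => hF.weakPartial_weakPartial_rpow_mul hΩ hp hFc hpos (hG i j) s k l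
  filter_upwards [h1, h2, ae_restrict_mem hΩ.measurableSet] with x h1 h2 hx
  have key := scalarCurvAt_rpow_conformal (g := fun i j => G i j x)
    (h := fun i j => invMetric G i j x) (d := fun k i j => weakPartial Ω k (G i j) x)
    (fun i j => by rw [gs]) (invMetric_symm (hpd x hx)) (invMetric_mul (hpd x hx))
    (fun k i j => by rw [gs]) (fun k l i j => weakPartial Ω k (weakPartial Ω l (G i j)) x)
    (hpos x hx) (fun k => weakPartial Ω k F x) (fun k l => weakPartial Ω k (weakPartial Ω l F) x)
    (s := s) (by simpa using hs)
  rw [Fintype.card_fin, ← scalarCurv_eq_scalarCurvAt, ← laplace_eq_laplaceAt] at key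
  rw [← key, scalarCurv_eq_scalarCurvAt]
  congr 1
  · funext i j
    exact invMetric_smul (u := fun y => F y ^ s) (hpd x hx)
      (Real.rpow_pos_of_pos (hpos x hx) s).ne' i j
  · funext k i j
    exact h1 k i j
  · funext k l i j
    exact h2 k l i j

end Yamabe

/-! ### The subsolution inequality -/

section Subsolution

variable {n : ℕ} {M : Type*} [TopologicalSpace M] [ChartedSpace (Euc n) M]
  [IsManifold 𝓘(ℝ, Euc n) ∞ M]

theorem ConformalData.subsolutionIneq_of_hasScalarCurv (hn : 3 ≤ n) (D : ConformalData n M)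
    {p : ℝ≥0∞} (hp : 3 ≤ p)
    (hg : ∀ e ∈ Charts n M, ∀ i j, MemWLoc 2 p e.target (tcomp D.g.tensor e i j))
    (hρ : AEOn (n := n) (M := M) fun e x => 0 ≤ D.ρ (e.symm x))
    {ψ : M → ℝ} (hψc : Continuous ψ)
    (hψ : ∀ e ∈ Charts n M, MemWLoc 2 p e.target (fcomp ψ e)) (hψpos : ∀ q, 0 < 1 + ψ q)
    (hR : HasScalarCurv (fun q => ((1 + ψ q) ^ (expN n - 2)) • D.g.tensor q)
      (fun q => -(((n : ℝ) - 1) / (n : ℝ)) * D.τ q ^ 2))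
    {α : ℝ} (hα0 : 0 < α) (hα1 : α ≤ 1) (W : VField n M) :
    D.SubsolutionIneq (fun q => α * (1 + ψ q)) W := by
  intro e he
  have hn' : (3 : ℝ) ≤ n := by exact_mod_cast hn
  have hn2 : (n : ℝ) - 2 ≠ 0 := by linarith
  have hn1 : (n : ℝ) - 1 ≠ 0 := by linarith
  have hn0 : (n : ℝ) ≠ 0 := by linarith
  have hΩ := e.open_target
  have hF : MemWLoc 2 p e.target fun x => 1 + fcomp ψ e x := by
    simpa using (hψ e he).affine hΩ 1
  have hFc : ContinuousOn (fun x => 1 + fcomp ψ e x) e.target :=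
    continuousOn_const.add (hψc.comp_continuousOn e.continuousOn_symm)
  have hs : (expN n - 2) * ((n : ℝ) - 2) = 4 := by
    rw [expN]
    field_simp
    ring
  have key := scalarCurv_rpow_mul_ae hΩ hp (hg e he) (tcomp_tensor_symm D.g e)
    (fun x hx => posDef_tcomp_tensor D.g he hx) hFc (fun x _ => hψpos _) hF hs
  have l1 := laplace_affine_ae (G := D.G e) hΩ (hψ e he) 1
  have lα := laplace_affine_ae (G := D.G e) hΩ (hψ e he) α
  simp only [one_mul] at l1
  filter_upwards [key, l1, lα, hR e he, hρ e he, ae_restrict_mem hΩ.measurableSet]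
    with x key l1 lα hR hρ hx
  have hnorm := normSq_nonneg (posDef_tcomp_tensor D.g he hx)
    (fun i j y => tcomp D.σ e i j y + confKilling e.target (D.G e) (vcomp W e) i j y)
  have hR' : scalarCurv e.target
      (fun i j y => (1 + fcomp ψ e y) ^ (expN n - 2) * tcomp D.g.tensor e i j y) x
      = -(((n : ℝ) - 1) / (n : ℝ)) * D.τ (e.symm x) ^ 2 := hR
  rw [hR', show laplace e.target (tcomp D.g.tensor e) (fun x => 1 + fcomp ψ e x) x
    = laplace e.target (D.G e) (fcomp ψ e) x from l1] at key
  have hφ : 0 < 1 + ψ (e.symm x) := hψpos _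
  have hc : 0 ≤ constC n := div_nonneg (by linarith) (by linarith)
  have hb : 0 ≤ constB n := div_nonneg (by linarith) (by linarith)
  -- The prescribed scalar curvature, solved for the Laplacian. Here `Δψ` stands for `Δ(1 + ψ)`,
  -- since constants do not contribute.
  have hlap : laplace e.target (D.G e) (fcomp ψ e) x
      - constC n * scalarCurv e.target (D.G e) x * (1 + ψ (e.symm x))
      = constB n * D.τ (e.symm x) ^ 2 * (1 + ψ (e.symm x)) ^ (expN n - 1) := by
    have e1 : (1 + ψ (e.symm x)) ^ (expN n - 1)
        = (1 + ψ (e.symm x)) ^ (expN n - 2) * (1 + ψ (e.symm x)) := by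
      rw [← Real.rpow_add_one hφ.ne']
      congr 1
      ring
    have hu := (Real.rpow_pos_of_pos hφ (expN n - 2)).ne'
    have e2 : fcomp ψ e x = ψ (e.symm x) := rfl
    have e3 : tcomp D.g.tensor e = D.G e := rfl
    have e4 : expN n - 2 = 4 / ((n : ℝ) - 2) := by
      rw [eq_div_iff hn2, hs]
    rw [e1]
    rw [e2, e3] at key
    generalize (1 + ψ (e.symm x)) ^ (expN n - 2) = u at key hu ⊢
    rw [e4] at key
    generalize laplace e.target (D.G e) (fcomp ψ e) x = L at key ⊢
    generalize scalarCurv e.target (D.G e) x = R at key ⊢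
    rw [constB, constC]
    have hφ0 := hφ.ne'
    generalize 1 + ψ (e.symm x) = φ at key hφ0 ⊢
    field_simp at key ⊢
    linear_combination key
  -- This is where `α ≤ 1` enters: the exponent `N - 1` is at least `1`.
  have hpow : α ^ (expN n - 1) ≤ α := by
    have h1 : 1 ≤ expN n - 1 := by
      rw [expN, le_sub_iff_add_le, le_div_iff₀ (by linarith)]
      linarith
    simpa using Real.rpow_le_rpow_of_exponent_ge hα0 hα1 h1
  have hmain : 0 ≤ constB n * D.τ (e.symm x) ^ 2 * (1 + ψ (e.symm x)) ^ (expN n - 1)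
      * (α - α ^ (expN n - 1)) := by
    have := Real.rpow_nonneg hφ.le (expN n - 1)
    have := sub_nonneg.2 hpow
    positivity
  have hα : 0 < α * (1 + ψ (e.symm x)) := mul_pos hα0 hφ
  have t1 : 0 ≤ constC n * normSq (D.G e)
      (fun i j y => tcomp D.σ e i j y + confKilling e.target (D.G e) (vcomp W e) i j y) x
      * (α * (1 + ψ (e.symm x))) ^ (-expN n - 1) :=
    mul_nonneg (mul_nonneg hc hnorm) (Real.rpow_nonneg hα.le _)
  have t2 : 0 ≤ constC n * D.ρ (e.symm x) * (α * (1 + ψ (e.symm x))) ^ (-(expN n / 2)) :=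
    mul_nonneg (mul_nonneg hc hρ) (Real.rpow_nonneg hα.le _)
  have lα' : laplace e.target (D.G e) (fcomp (fun q => α * (1 + ψ q)) e) x
      = α * laplace e.target (D.G e) (fcomp ψ e) x := lα
  rw [ConformalData.lichnerowicz, lα', Real.mul_rpow hα0.le hφ.le (z := expN n - 1)]
  -- Substituting `α` times the equation for `1 + ψ` leaves the surplus `α - α^(N-1)` in the `τ²`
  -- term and the two nonnegative source terms.
  linear_combination hmain + t1 + t2 - α * hlap

end Subsolution

end AEConstraint

open AEConstraint in
theorem mainTheorem5 (n : ℕ) (hn : 3 ≤ n)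
    {M : Type*} [TopologicalSpace M] [T2Space M] [SecondCountableTopology M]
    [ChartedSpace (Euc n) M] [IsManifold 𝓘(ℝ, Euc n) ∞ M]
    (A : AsymptoticEnds n M) (p γ : ℝ) (hp : (n : ℝ) < p)
    (hγ : 2 * (2 - (n : ℝ)) < γ) (hγ0 : γ < 0)
    (D : ConformalData n M) (hD : D.IsAdmissible A p γ)
    (ψ : M → ℝ) (hψc : Continuous ψ)
    (hψ : MemW A 2 (ENNReal.ofReal p) (γ / 2) (fcomp ψ))
    (hψpos : ∀ q, 0 < 1 + ψ q)
    (hR : HasScalarCurv (fun q => ((1 + ψ q) ^ (expN n - 2)) • D.g.tensor q)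
      (fun q => -(((n : ℝ) - 1) / (n : ℝ)) * D.τ q ^ 2))
    (α : ℝ) (hα0 : 0 < α) (hα1 : α ≤ 1) :
    D.IsGlobalSubsolution A p (γ / 2) (fun q => α * (1 + ψ q)) ∧
    ∀ (φ : M → ℝ) (W : VField n M), MemLpLoc n p φ →
      AEOn (n := n) (M := M) (fun e x => 0 < φ (e.symm x)) →
      D.SolvesVector A p (γ / 2) φ W →
      D.SubsolutionIneq (fun q => α * (1 + ψ q)) W := by
  have hn' : (3 : ℝ) ≤ n := by exact_mod_cast hn
  have hp3 : (3 : ℝ≥0∞) ≤ ENNReal.ofReal p := by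
    rw [← ENNReal.ofReal_ofNat 3]
    exact ENNReal.ofReal_le_ofReal (hn'.trans hp.le)
  have key (W : VField n M) : D.SubsolutionIneq (fun q => α * (1 + ψ q)) W :=
    D.subsolutionIneq_of_hasScalarCurv hn hp3 hD.metric.2.1 hD.rho_nonneg hψc hψ.1 hψpos hR
      hα0 hα1 W
  exact ⟨⟨fun q => mul_pos hα0 (hψpos q), fun e he => (hψ.1 e he).affine e.open_target α,
    fun _ W _ _ _ => key W⟩, fun _ W _ _ _ => key W⟩
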